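/- All graphs are finite and simple, and graphs are identified up to isomorphism. For a graph $G$ with adjacency matrix $A(G)$ and diagonal degree matrix $D(G)$, let $q(G)$ be the largest eigenvalue of $D(G)+A(G)$, and let $\delta(G)$ be the minimum degree of $G$. A graph is Hamilton-connected if every two distinct vertices are joined by a path containing all vertices. Write $G+H$ for disjoint union, $G\vee H$ for the join, and $mK_1$ for the graph with $m$ vertices and no edges. For $k\ge 2$ and $n>2k$ put $$S_n^k=K_k\vee\bigl(K_{n-2k+1}+(k-1)K_1\bigr),\qquad T_n^k=K_2\vee\bigl(K_{n-k-1}+K_{k-1}\bigr).$$ For $H\in\{S_n^k,T_n^k\}$ let $Y$ and $Z$ be the sets of vertices of $H$ of degree $n-1$ and $n-k$ respectively, and let $E_0(H)$ be the set of edges of $H$ with both endpoints in $Y\cup Z$. Define $$\mathcal S_k^{(1)}(n)=\Bigl\{S_n^k-E' : E'\subseteq E_0(S_n^k),\ |E'|\le\Bigl\lfloor\tfrac{k(k-1)}{4}\Bigr\rfloor\Bigr\},\qquad \mathcal T_k^{(1)}(n)=\Bigl\{T_n^k-E' : E'\subseteq E_0(T_n^k),\ |E'|\le\Bigl\lfloor\tfrac{k-1}{2}\Bigr\rfloor\Bigr\}.$$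 **Theorem.** Let $k\ge 2$, let $n\ge k^4+5k^3+2k^2+8k+12$, and let $G$ be a graph of order $n$ with $\delta(G)\ge k$. If $q(G)\ge 2n-2k$, then $G$ is Hamilton-connected unless $G\in\mathcal S_k^{(1)}(n)\cup\mathcal T_k^{(1)}(n)$. -/

import Mathlib

namespace HamConn

/-- A graph is Hamilton-connected if every two distinct vertices are joined by a Hamilton path. -/
def HamiltonConnected {V : Type*} [DecidableEq V] (G : SimpleGraph V) : Prop :=
  ∀ u v : V, u ≠ v → ∃ p : G.Walk u v, p.IsHamiltonian

/-- The signless Laplacian matrix `Q(G) = D(G) + A(G)`. -/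
def signlessLaplacian {V : Type*} [Fintype V] [DecidableEq V] (G : SimpleGraph V)
    [DecidableRel G.Adj] : Matrix V V ℝ :=
  Matrix.diagonal (fun v => (G.degree v : ℝ)) + G.adjMatrix ℝ

/-- The signless Laplacian spectral radius `q(G)`: the largest eigenvalue of `Q(G)`. -/
noncomputable def q {V : Type*} [Fintype V] [DecidableEq V] (G : SimpleGraph V)
    [DecidableRel G.Adj] : ℝ :=
  sSup {μ : ℝ | Module.End.HasEigenvalue (Matrix.toLin' (signlessLaplacian G)) μ}

/-- As soon as there is a vertex, the supremum defining `q(G)` is attained: it really is the largest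
eigenvalue. -/
theorem isGreatest_q {V : Type*} [Fintype V] [DecidableEq V] [Nonempty V] (G : SimpleGraph V)
    [DecidableRel G.Adj] :
    IsGreatest {μ : ℝ | Module.End.HasEigenvalue (Matrix.toLin' (signlessLaplacian G)) μ} (q G) := by
  have hfin : {μ : ℝ | Module.End.HasEigenvalue
      (Matrix.toLin' (signlessLaplacian G)) μ}.Finite :=
    Module.End.finite_hasEigenvalue _
  have hH : (signlessLaplacian G).IsHermitian := by
    refine Matrix.IsHermitian.add (Matrix.isHermitian_diagonal _) ?_
    rw [Matrix.IsHermitian, Matrix.conjTranspose_eq_transpose_of_trivial]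
    exact SimpleGraph.transpose_adjMatrix G
  have hne : {μ : ℝ | Module.End.HasEigenvalue
      (Matrix.toLin' (signlessLaplacian G)) μ}.Nonempty := by
    obtain ⟨v⟩ := ‹Nonempty V›
    refine ⟨hH.eigenvalues v, ?_⟩
    rw [Set.mem_ofPred_eq, Module.End.hasEigenvalue_iff_mem_spectrum, Matrix.spectrum_toLin']
    exact hH.eigenvalues_mem_spectrum_real v
  exact ⟨hne.csSup_mem hfin, fun μ hμ => le_csSup hfin.bddAbove hμ⟩

/-- The join `G ∨ H`: the disjoint union of `G` and `H` together with all edges between them. -/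
def join {V W : Type*} (G : SimpleGraph V) (H : SimpleGraph W) : SimpleGraph (V ⊕ W) :=
  G.sum H ⊔ completeBipartiteGraph V W

/-- `S_n^k = K_k ∨ (K_{n-(2k-1)} + (k-1) K_1)`. -/
def S (n k : ℕ) : SimpleGraph (Fin k ⊕ (Fin (n - (2 * k - 1)) ⊕ Fin (k - 1))) :=
  join (SimpleGraph.completeGraph (Fin k))
    ((SimpleGraph.completeGraph (Fin (n - (2 * k - 1)))).sum (⊥ : SimpleGraph (Fin (k - 1))))

/-- `T_n^k = K_2 ∨ (K_{n-(k+1)} + K_{k-1})`. -/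
def T (n k : ℕ) : SimpleGraph (Fin 2 ⊕ (Fin (n - (k + 1)) ⊕ Fin (k - 1))) :=
  join (SimpleGraph.completeGraph (Fin 2))
    ((SimpleGraph.completeGraph (Fin (n - (k + 1)))).sum (SimpleGraph.completeGraph (Fin (k - 1))))

open scoped Classical in
/-- The set `Y ∪ Z` of the vertices of degree `n - 1` or `n - k` in a graph `H`
(used for `H = S_n^k` and `H = T_n^k`). -/
def YZ {W : Type*} [Fintype W] (H : SimpleGraph W) (n k : ℕ) : Set W :=
  {v | H.degree v = n - 1 ∨ H.degree v = n - k}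

/-- The set `E₀` of the edges of `H` with both endpoints in `Y ∪ Z`. -/
def E₀ {W : Type*} [Fintype W] (H : SimpleGraph W) (n k : ℕ) : Set (Sym2 W) :=
  {e ∈ H.edgeSet | ∀ v ∈ e, v ∈ YZ H n k}

/-- `G` is, up to isomorphism, obtained from `H` by deleting a set `E' ⊆ E₀` of at most `m` edges. -/
def IsDeletion {V W : Type*} [Fintype W] (G : SimpleGraph V) (H : SimpleGraph W)
    (n k m : ℕ) : Prop :=
  ∃ E' : Finset (Sym2 W), (E' : Set (Sym2 W)) ⊆ E₀ H n k ∧ E'.card ≤ m ∧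
    Nonempty (G ≃g H.deleteEdges (E' : Set (Sym2 W)))

/-- Membership in `𝒮_k^{(1)}(n)`; the bound `⌊k(k-1)/4⌋` is natural-number division. -/
def MemS1 {V : Type*} (G : SimpleGraph V) (n k : ℕ) : Prop :=
  IsDeletion G (S n k) n k (k * (k - 1) / 4)

/-- Membership in `𝒯_k^{(1)}(n)`; the bound `⌊(k-1)/2⌋` is natural-number division. -/
def MemT1 {V : Type*} (G : SimpleGraph V) (n k : ℕ) : Prop :=
  IsDeletion G (T n k) n k ((k - 1) / 2)

end HamConn

/-!
Suppose `G` satisfies the hypotheses but is not Hamilton-connected, and enlarge it to an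
edge-maximal graph `H` on the same vertices that is not Hamilton-connected.

*Few non-edges.* Comparing an eigenvector of `q(G)` with the degree vector gives
`(n - 1) q(G) ≤ 2 e(G) + (n - 1)(n - 2)` (`q_mul_le`), so `q(G) ≥ 2 n - 2 k` leaves at most
`(n - 1)(k - 1)` pairs of nonadjacent vertices in `G`, hence in `H`.

*Structure of `H`.* By the crossing argument of Bondy and Chvátal
(`degree_add_degree_le_of_maximal`), nonadjacent vertices of `H` have degree sum at most `n`.
The vertices of degree above `n / 2` therefore form a clique. A maximal clique `C` containing them
omits `t` vertices, each of degree at most `t + 1`; counting non-edges forces `t = k - 1`, so these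
vertices have degree exactly `k`. The set `Y` of vertices of `C` with a neighbour outside `C` is
joined to everything. Put `s = |Y|`; then the outside vertices induce a `(k - s)`-regular graph,
whence `2 ≤ s ≤ k`. If `s = k` then `H` is `S_n^k`; if `s = 2` it is `T_n^k`. In the intermediate
cases the outside vertices are covered by at most `s - 2` disjoint paths (`exists_path_cover`);
together with the clique `C \ Y` these can be linked through `Y` into a Hamilton path with
prescribed ends (`hamiltonConnected_of_cover`), which contradicts the choice of `H`.

*Missing edges.* The `k - 1` vertices outside `C` already have the least permitted degree in `H`,
so `G` arises from `H` by deleting edges inside `C`. On the complete graph on `C`, whose form has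
the simple top eigenvalue `2 (n - k)` and a spectral gap of order `n`, the `c = (k - 1) s` edges
leaving `C` raise the quadratic form of the signless Laplacian on the constant vector by `c`, and
each deletion lowers it by `4`. All other effects are absorbed by the gap when `n` is of order
`k ^ 4` (`quadForm_lt`), so `m` deletions with `4 m ≥ c + 2` give `q(G) < 2 (n - k)`
(`q_lt_of_missing_edges`). As `c` is even, at most `⌊c / 4⌋` edges are missing, and `G` belongs to one of the
two families (`IsBlockPartition.isDeletion`).
-/

namespace HamConn

/-! ### Hamilton paths as vertex lists -/

/-- The list `l` is the vertex sequence of a Hamilton path of `G` from `u` to `v`. -/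
structure IsHamList {V : Type*} (G : SimpleGraph V) (u v : V) (l : List V) : Prop where
  nodup : l.Nodup
  mem : ∀ w, w ∈ l
  chain : l.IsChain G.Adj
  head : l.head? = some u
  last : l.getLast? = some v

theorem hamiltonConnected_iff {V : Type*} [DecidableEq V] {G : SimpleGraph V} :
    HamiltonConnected G ↔ ∀ u v : V, u ≠ v → ∃ l, IsHamList G u v l := by
  refine forall₃_congr fun u v _ => ⟨?_, ?_⟩
  · rintro ⟨p, hp⟩
    refine ⟨p.support, hp.isPath.support_nodup, hp.mem_support, p.isChain_adj_support, ?_, ?_⟩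
    · rw [List.head?_eq_some_head p.support_ne_nil, p.head_support]
    · rw [List.getLast?_eq_some_getLast p.support_ne_nil, p.getLast_support]
  · rintro ⟨l, hl⟩
    have hne : l ≠ [] := by rintro rfl; simpa using hl.head
    have hu : l.head hne = u := by
      have := hl.head
      rwa [List.head?_eq_some_head hne, Option.some_inj] at this
    have hv : l.getLast hne = v := by
      have := hl.last
      rwa [List.getLast?_eq_some_getLast hne, Option.some_inj] at this
    subst hu hv
    refine ⟨SimpleGraph.Walk.ofSupport l hne hl.chain, fun a => ?_⟩
    rw [SimpleGraph.Walk.support_ofSupport]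
    exact List.count_eq_one_of_mem hl.nodup (hl.mem a)

theorem isChain_reverse {V : Type*} {G : SimpleGraph V} {l : List V} (h : l.IsChain G.Adj) :
    l.reverse.IsChain G.Adj := by
  rw [List.isChain_reverse]
  exact h.imp fun _ _ hab => hab.symm

theorem IsHamList.reverse {V : Type*} {G : SimpleGraph V} {u v : V} {l : List V}
    (h : IsHamList G u v l) : IsHamList G v u l.reverse :=
  ⟨by simpa using h.nodup, by simpa using h.mem, isChain_reverse h.chain,
    by simpa using h.last, by simpa using h.head⟩

/-! ### The crossing argument of Bondy and Chvátal -/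

/-- If no element satisfying `p` is immediately followed by one satisfying `q`, then each of the
`l.length - 1` consecutive pairs is counted at most once on the left. -/
theorem countP_dropLast_add_countP_tail_le {V : Type*} (p q : V → Bool) (l : List V)
    (h : ∀ C w s D, l = C ++ w :: s :: D → ¬ (p w ∧ q s)) :
    l.dropLast.countP p + l.tail.countP q ≤ l.length - 1 := by
  induction l with
  | nil => simp
  | cons a l ih =>
    cases l with
    | nil => simp
    | cons b l =>
      have ih' := ih fun C w s D e => h (a :: C) w s D (by simp [e])
      have h0 := h [] a b l rfl
      simp only [List.dropLast_cons_cons, List.tail_cons, List.countP_cons, List.length_cons] at *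
      by_cases hp : p a <;> by_cases hq : q b <;> simp_all <;> omega

theorem degree_eq_countP {V : Type*} [Fintype V] [DecidableEq V] (G : SimpleGraph V)
    [DecidableRel G.Adj] (a : V) {l : List V} (hl : l.Nodup) (hm : ∀ w, w ∈ l) :
    G.degree a = l.countP (fun w => decide (G.Adj a w)) := by
  rw [List.countP_eq_length_filter, ← List.toFinset_card_of_nodup (hl.filter _),
    ← G.card_neighborFinset_eq_degree]
  congr 1
  ext w
  simp [hm]

/-- Along a Hamilton path in which only the step from `a` to `b` may fail to be an edge of `G`,
that step can be avoided as soon as `d(a) + d(b) > n`. -/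
theorem IsHamList.exists_of_degree_add {V : Type*} [Fintype V] [DecidableEq V]
    {G : SimpleGraph V} [DecidableRel G.Adj] {u v a b : V} {A B : List V}
    (hnd : (A ++ a :: b :: B).Nodup) (hmem : ∀ w, w ∈ A ++ a :: b :: B)
    (hhead : (A ++ a :: b :: B).head? = some u) (hlast : (A ++ a :: b :: B).getLast? = some v)
    (hA : (A ++ [a]).IsChain G.Adj) (hB : (b :: B).IsChain G.Adj) (hab : ¬ G.Adj a b)
    (hdeg : Fintype.card V < G.degree a + G.degree b) : ∃ l, IsHamList G u v l := by
  by_contra hno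
  have key : ∀ l : List V, l.IsChain G.Adj → l.Perm (A ++ a :: b :: B) →
      l.head? = (A ++ a :: b :: B).head? → l.getLast? = (A ++ a :: b :: B).getLast? → False := by
    intro l h1 h2 h3 h4
    exact hno ⟨l, h2.nodup_iff.2 hnd, fun w => h2.mem_iff.2 (hmem w), h1, h3.trans hhead,
      h4.trans hlast⟩
  have h1 := countP_dropLast_add_countP_tail_le (fun w => decide (G.Adj a w))
    (fun w => decide (G.Adj b w)) (A ++ [a]) (by
      rintro C w s D e ⟨hw, hs⟩
      simp only [decide_eq_true_eq] at hw hs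
      rw [e] at hA
      have hC : (C ++ [w]).IsChain G.Adj := (List.isChain_split.1 hA).1
      have hD : (s :: D).IsChain G.Adj := ((List.isChain_split.1 hA).2).of_cons
      have hl : (s :: D).getLast? = some a := by
        have := congrArg List.getLast? e
        simpa using this.symm
      have e2 : A ++ a :: b :: B = C ++ w :: s :: D ++ b :: B := by rw [← e]; simp
      refine key ((C ++ [w]) ++ ((s :: D).reverse ++ b :: B)) ?_ ?_ ?_ ?_
      · refine List.isChain_append.2 ⟨hC, List.isChain_append.2 ⟨isChain_reverse hD, hB, ?_⟩, ?_⟩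
        · intro x hx y hy
          simp at hx hy
          subst hx hy
          exact hs.symm
        · intro x hx y hy
          rw [List.head?_append, List.head?_reverse, hl] at hy
          simp at hx hy
          subst hx hy
          exact hw.symm
      · rw [e2, ← List.append_assoc]
        refine List.Perm.append_right _ ?_
        rw [List.append_assoc]
        exact ((List.reverse_perm _).cons w).append_left C
      · rw [e2]; cases C <;> simp
      · rw [e2]; simp [List.getLast?_append, List.getLast?_cons])
  have h2 := countP_dropLast_add_countP_tail_le (fun w => decide (G.Adj a w))
    (fun w => decide (G.Adj b w)) (b :: B) (by
      rintro C w s D e ⟨hw, hs⟩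
      simp only [decide_eq_true_eq] at hw hs
      rw [e] at hB
      have hC : (C ++ [w]).IsChain G.Adj := (List.isChain_split.1 hB).1
      have hD : (s :: D).IsChain G.Adj := ((List.isChain_split.1 hB).2).of_cons
      have hh : (C ++ [w]).head? = some b := by
        have := congrArg List.head? e
        cases C <;> simp_all
      have e2 : A ++ a :: b :: B = A ++ a :: (C ++ w :: s :: D) := by rw [← e]
      refine key ((A ++ [a]) ++ ((C ++ [w]).reverse ++ s :: D)) ?_ ?_ ?_ ?_
      · refine List.isChain_append.2 ⟨hA, List.isChain_append.2 ⟨isChain_reverse hC, hD, ?_⟩, ?_⟩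
        · intro x hx y hy
          rw [List.getLast?_reverse, hh] at hx
          simp at hx hy
          subst hx hy
          exact hs
        · intro x hx y hy
          simp at hx hy
          subst hx hy
          exact hw
      · rw [e2]
        have : A ++ a :: (C ++ w :: s :: D) = (A ++ [a]) ++ ((C ++ [w]) ++ s :: D) := by simp
        rw [this]
        exact ((List.reverse_perm _).append_right _).append_left _
      · rw [e2]; cases A <;> simp
      · rw [e2]; simp [List.getLast?_append, List.getLast?_cons])
  have hba : ¬ G.Adj b a := fun h => hab h.symm
  have d1 := degree_eq_countP G a hnd hmem
  have d2 := degree_eq_countP G b hnd hmem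
  have hn : Fintype.card V = (A ++ a :: b :: B).length := by
    rw [← List.toFinset_card_of_nodup hnd, ← Finset.card_univ]
    congr 1
    ext w
    have := hmem w
    simp at this ⊢
    tauto
  have t1 : List.countP (fun w => decide (G.Adj b w)) A ≤
      List.countP (fun w => decide (G.Adj b w)) (A ++ [a]).tail + 1 := by
    cases A with
    | nil => simp
    | cons c A => simp [List.countP_cons]; split_ifs <;> omega
  have t2 : List.countP (fun w => decide (G.Adj a w)) B ≤
      List.countP (fun w => decide (G.Adj a w)) (b :: B).dropLast + 1 := by
    have : b :: B = (b :: B).dropLast ++ [(b :: B).getLast (by simp)] :=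
      (List.dropLast_append_getLast _).symm
    have h3 := congrArg (List.countP (fun w => decide (G.Adj a w))) this
    rw [List.countP_append, List.countP_cons] at h3
    have h4 : List.countP (fun w => decide (G.Adj a w)) [(b :: B).getLast (by simp)] ≤ 1 :=
      List.countP_le_length
    omega
  simp [List.countP_append, hab, hba] at d1 d2 h1 h2 hn
  omega

/-- In a graph that is maximal among those that are not Hamilton-connected, two nonadjacent
vertices have degree sum at most the order. -/
theorem degree_add_degree_le_of_maximal {V : Type*} [Fintype V] [DecidableEq V]
    {H : SimpleGraph V} [DecidableRel H.Adj]
    (hH : ¬ HamiltonConnected H) (hmax : ∀ H', H < H' → HamiltonConnected H')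
    {x y : V} (hxy : x ≠ y) (hadj : ¬ H.Adj x y) :
    H.degree x + H.degree y ≤ Fintype.card V := by
  by_contra hdeg
  push Not at hdeg
  apply hH
  rw [hamiltonConnected_iff]
  intro u v huv
  have hlt : H < H ⊔ SimpleGraph.edge x y := by
    refine lt_of_le_of_ne le_sup_left fun h => hadj ?_
    rw [h]
    simp [SimpleGraph.edge_adj, hxy]
  obtain ⟨l, hl⟩ := hamiltonConnected_iff.1 (hmax _ hlt) u v huv
  by_cases hch : l.IsChain H.Adj
  · exact ⟨l, hl.nodup, hl.mem, hch, hl.head, hl.last⟩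
  rw [List.isChain_iff_forall_rel_of_append_cons_cons] at hch
  push Not at hch
  obtain ⟨a, b, A, B, rfl, hab⟩ := hch
  have hc := hl.chain
  rw [List.isChain_append_cons_cons] at hc
  obtain ⟨hA, hab', hB⟩ := hc
  have hnd := hl.nodup
  have hset : (a = x ∧ b = y) ∨ (a = y ∧ b = x) := by
    rw [SimpleGraph.sup_adj, SimpleGraph.edge_adj] at hab'
    rcases hab' with h | h
    · exact absurd h hab
    · tauto
  have hA' : (A ++ [a]).IsChain H.Adj := by
    refine List.IsChain.imp_of_mem_imp ?_ hA
    intro c d hc hd hcd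
    have h1 : c ≠ b := by rintro rfl; simp [List.nodup_append] at hnd hc; grind
    have h2 : d ≠ b := by rintro rfl; simp [List.nodup_append] at hnd hd; grind
    rw [SimpleGraph.sup_adj, SimpleGraph.edge_adj] at hcd
    grind
  have hB' : (b :: B).IsChain H.Adj := by
    refine List.IsChain.imp_of_mem_imp ?_ hB
    intro c d hc hd hcd
    have h1 : c ≠ a := by rintro rfl; simp [List.nodup_append] at hnd hc; grind
    have h2 : d ≠ a := by rintro rfl; simp [List.nodup_append] at hnd hd; grind
    rw [SimpleGraph.sup_adj, SimpleGraph.edge_adj] at hcd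
    grind
  refine IsHamList.exists_of_degree_add hnd hl.mem hl.head hl.last hA' hB' hab ?_
  rcases hset with ⟨rfl, rfl⟩ | ⟨rfl, rfl⟩ <;> omega

/-! ### Hamilton-connectedness from a path cover -/

/-- Clique vertices `y :: ys` joined to all vertices of at most `ys.length` given paths can be
threaded through these paths; the resulting path starts at `y` and ends at the last clique
vertex. -/
theorem exists_chain_through {V : Type*} {G : SimpleGraph V} (ys : List V) (y : V)
    (Ls : List (List V)) (hch : ∀ L ∈ Ls, L.IsChain G.Adj)
    (hys : (y :: ys).Pairwise G.Adj) (hadj : ∀ a ∈ y :: ys, ∀ b ∈ Ls.flatten, G.Adj a b)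
    (hlen : Ls.length ≤ ys.length) :
    ∃ l : List V, l.IsChain G.Adj ∧ l.Perm (y :: ys ++ Ls.flatten) ∧ l.head? = some y ∧
      l.getLast? = (y :: ys).getLast? := by
  induction ys generalizing y Ls with
  | nil =>
    have : Ls = [] := by simpa using hlen
    subst this
    exact ⟨[y], by simp, by simp, by simp, by simp⟩
  | cons z ys ih =>
    have hyz : G.Adj y z := (List.pairwise_cons.1 hys).1 z (by simp)
    cases Ls with
    | nil =>
      obtain ⟨l, h1, h2, h3, h4⟩ := ih z [] (by simp) hys.of_cons (by simp) (by simp)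
      refine ⟨y :: l, ?_, by simpa using h2, by simp, ?_⟩
      · refine List.isChain_cons.2 ⟨?_, h1⟩
        simp [h3, hyz]
      · rw [List.getLast?_cons, h4]; simp [List.getLast?_cons]
    | cons L Ls =>
      obtain ⟨l, h1, h2, h3, h4⟩ := ih z Ls (fun M hM => hch M (by simp [hM])) hys.of_cons
        (fun a ha b hb => hadj a (List.mem_cons_of_mem _ ha) b
          (by rw [List.flatten_cons, List.mem_append]; exact Or.inr hb)) (by simpa using hlen)
      have hyL : ∀ a ∈ y :: z :: ys, ∀ b ∈ L, G.Adj a b := fun a ha b hb =>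
        hadj a ha b (by rw [List.flatten_cons, List.mem_append]; exact Or.inl hb)
      refine ⟨y :: (L ++ l), ?_, ?_, by simp, ?_⟩
      · refine List.isChain_cons.2 ⟨?_, List.isChain_append.2 ⟨hch L (by simp), h1, ?_⟩⟩
        · intro b hb
          rw [List.head?_append, h3] at hb
          cases L with
          | nil => simp at hb; exact hb ▸ hyz
          | cons c L => simp at hb; exact hb ▸ hyL y (by simp) c (by simp)
        · intro a ha b hb
          rw [h3] at hb
          simp at hb
          subst hb
          exact (hyL z (by simp) a (List.mem_of_getLast? ha)).symm
      · have : (L ++ l).Perm (z :: ys ++ (L ++ Ls.flatten)) :=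
          (h2.append_left L).trans (by
            rw [← List.append_assoc, ← List.append_assoc]
            exact List.perm_append_comm.append_right _)
        simpa using this
      · rw [List.getLast?_cons, List.getLast?_append, h4]; simp [List.getLast?_cons]

/-- A vertex `w` on one of the given paths can be made the last vertex of a path by cutting. -/
theorem exists_split_getLast {V : Type*} {G : SimpleGraph V} {Ls : List (List V)}
    (hch : ∀ L ∈ Ls, L.IsChain G.Adj) {w : V} (hw : w ∈ Ls.flatten) :
    ∃ (L : List V) (Ls' : List (List V)), L.IsChain G.Adj ∧ L.getLast? = some w ∧
      (∀ M ∈ Ls', M.IsChain G.Adj) ∧ Ls'.length ≤ Ls.length ∧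
      (L ++ Ls'.flatten).Perm Ls.flatten := by
  obtain ⟨M, hM, hwM⟩ := List.mem_flatten.1 hw
  obtain ⟨A, B, rfl⟩ := List.append_of_mem hwM
  obtain ⟨X, Z, rfl⟩ := List.append_of_mem hM
  have hc := List.isChain_split.1 (hch _ hM)
  refine ⟨A ++ [w], B :: (X ++ Z), hc.1, by simp, ?_, by simp, ?_⟩
  · intro N hN
    rcases List.mem_cons.1 hN with rfl | hN
    · exact hc.2.of_cons
    · exact hch N (by simp at hN ⊢; tauto)
  · simp only [List.flatten_cons, List.flatten_append]
    have : A ++ [w] ++ (B ++ (X.flatten ++ Z.flatten)) =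
      ((A ++ w :: B) ++ X.flatten) ++ Z.flatten := by simp
    rw [this, ← List.append_assoc]
    exact List.perm_append_comm.append_right _

/-- If the vertices outside a clique `ys` joined to everything can be covered by fewer than
`ys.length` disjoint paths, then the graph is Hamilton-connected. -/
theorem hamiltonConnected_of_cover {V : Type*} [DecidableEq V] {G : SimpleGraph V}
    (ys : List V) (Ls : List (List V)) (hch : ∀ L ∈ Ls, L.IsChain G.Adj)
    (hys : ys.Pairwise G.Adj) (hadj : ∀ a ∈ ys, ∀ b ∈ Ls.flatten, G.Adj a b)
    (hlen : Ls.length < ys.length) (hnd : (ys ++ Ls.flatten).Nodup)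
    (hmem : ∀ w, w ∈ ys ++ Ls.flatten) : HamiltonConnected G := by
  have perm_ys : ∀ {zs : List V}, zs.Perm ys → zs.Pairwise G.Adj := fun h =>
    (h.pairwise_iff fun hab => hab.symm).2 hys
  have fin : ∀ {u v : V} {l : List V}, l.Perm (ys ++ Ls.flatten) → l.IsChain G.Adj →
      l.head? = some u → l.getLast? = some v → ∃ l, IsHamList G u v l := fun hp h1 h2 h3 =>
    ⟨_, hp.nodup_iff.2 hnd, fun w => hp.mem_iff.2 (hmem w), h1, h2, h3⟩
  -- one end in the clique, the other one on a path of the cover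
  have mixed : ∀ u v : V, u ∈ ys → v ∈ Ls.flatten → ∃ l, IsHamList G u v l := by
    intro u v hu hv
    obtain ⟨L, Ls', hL, hLv, hLs', hlen', hp⟩ := exists_split_getLast hch hv
    have hpe := List.perm_cons_erase hu
    obtain ⟨l, h1, h2, h3, h4⟩ := exists_chain_through (ys.erase u) u Ls' hLs'
      (perm_ys hpe.symm)
      (fun a ha b hb => hadj a (hpe.mem_iff.2 ha) b (hp.mem_iff.1 (by simp [hb])))
      (by have := hpe.length_eq; simp at this; omega)
    refine fin (l := l ++ L) ?_ (List.isChain_append.2 ⟨h1, hL, ?_⟩) (by simp [h3])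
      (by simp [hLv])
    · refine (h2.append_right L).trans ?_
      rw [List.append_assoc]
      exact (hpe.symm.append_right _).trans ((List.perm_append_comm.trans hp).append_left _)
    · intro a ha b hb
      rw [h4] at ha
      exact hadj a (hpe.mem_iff.2 (List.mem_of_getLast? ha)) b
        (hp.mem_iff.1 (by simp [List.mem_of_head? hb]))
  rw [hamiltonConnected_iff]
  intro u v huv
  rcases List.mem_append.1 (hmem u) with hu | hu <;> rcases List.mem_append.1 (hmem v) with hv | hv
  · have hp1 := List.perm_cons_erase hu
    have hv' : v ∈ ys.erase u := (List.mem_erase_of_ne huv.symm).2 hv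
    have hp2 := List.perm_cons_erase hv'
    have hp : (u :: ((ys.erase u).erase v ++ [v])).Perm ys :=
      ((List.perm_append_comm.trans hp2.symm).cons u).trans hp1.symm
    obtain ⟨l, h1, h2, h3, h4⟩ := exists_chain_through ((ys.erase u).erase v ++ [v]) u Ls hch
      (perm_ys hp) (fun a ha b hb => hadj a (hp.mem_iff.1 ha) b hb)
      (by have := hp.length_eq; simp at this ⊢; omega)
    exact fin (h2.trans (hp.append_right _)) h1 h3 (by rw [h4, List.getLast?_cons]; simp)
  · exact mixed u v hu hv
  · obtain ⟨l, hl⟩ := mixed v u hv hu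
    exact ⟨_, hl.reverse⟩
  · -- both ends are turned into ends of paths; the clique links all the others in between
    have finish : ∀ (L M : List V) (Ks : List (List V)), L.IsChain G.Adj → M.IsChain G.Adj →
        (∀ K ∈ Ks, K.IsChain G.Adj) → L.head? = some u → M.getLast? = some v →
        Ks.length ≤ Ls.length → (L ++ M ++ Ks.flatten).Perm Ls.flatten →
        ∃ l, IsHamList G u v l := by
      intro L M Ks hL hM hKs hLu hMv hlenK hp
      cases ys with
      | nil => simp at hlen
      | cons y ys =>
      obtain ⟨l, h1, h2, h3, h4⟩ := exists_chain_through ys y Ks hKs hys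
        (fun a ha b hb => hadj a ha b (hp.mem_iff.1 (by simp [hb])))
        (by simp at hlen; omega)
      refine fin (l := L ++ (l ++ M)) ?_ (List.isChain_append.2
        ⟨hL, List.isChain_append.2 ⟨h1, hM, ?_⟩, ?_⟩) (by simp [hLu]) (by simp [hMv])
      · refine List.Perm.trans ?_ (hp.append_left (y :: ys))
        refine ((h2.append_right M).append_left L).trans ?_
        generalize y :: ys = Y
        generalize Ks.flatten = K
        rw [List.append_assoc, ← List.append_assoc L, ← List.append_assoc Y]
        have e1 : (L ++ Y).Perm (Y ++ L) := List.perm_append_comm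
        have e2 : (K ++ M).Perm (M ++ K) := List.perm_append_comm
        simpa using e1.append e2
      · intro a ha b hb
        rw [h4] at ha
        exact hadj a (List.mem_of_getLast? ha) b
          (hp.mem_iff.1 (by simp [List.mem_of_head? hb]))
      · intro a ha b hb
        rw [List.head?_append, h3] at hb
        simp at hb
        subst hb
        exact (hadj y (by simp) a (hp.mem_iff.1 (by simp [List.mem_of_getLast? ha]))).symm
    obtain ⟨L, Ls', hL, hLv, hLs', hlen', hp⟩ := exists_split_getLast hch hv
    rcases List.mem_append.1 (hp.mem_iff.2 hu) with huL | huL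
    · obtain ⟨A, B, rfl⟩ := List.append_of_mem huL
      have hc := List.isChain_split.1 hL
      have hB : B.getLast? = some v := by
        cases B with
        | nil => simp at hLv; exact absurd hLv huv
        | cons b B => simpa [List.getLast?_append, List.getLast?_cons] using hLv
      refine finish (A ++ [u]).reverse B Ls' (isChain_reverse hc.1) hc.2.of_cons hLs' (by simp) hB
        hlen' (List.Perm.trans ?_ hp)
      have := ((List.reverse_perm (A ++ [u])).append_right B).append_right Ls'.flatten
      simpa using this
    · obtain ⟨M, Ks, hM, hMu, hKs, hlenK, hp'⟩ := exists_split_getLast hLs' huL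
      refine finish M.reverse L Ks (isChain_reverse hM) hL hKs (by simpa using hMu) hLv
        (hlenK.trans hlen') (List.Perm.trans ?_ hp)
      refine ((((List.reverse_perm M).append_right L).trans
        List.perm_append_comm).append_right _).trans ?_
      rw [List.append_assoc]
      exact hp'.append_left L

/-! ### Path covers under a minimum degree condition -/

/-- Disjoint paths inside `R` extend to a cover of `R` by adding one-vertex paths. -/
theorem exists_cover_extending {V : Type*} [DecidableEq V] {G : SimpleGraph V} (R : Finset V)
    (Ls : List (List V)) (hch : ∀ L ∈ Ls, L.IsChain G.Adj) (hnd : Ls.flatten.Nodup)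
    (hR : ∀ w ∈ Ls.flatten, w ∈ R) :
    ∃ Ks : List (List V), (∀ K ∈ Ks, K.IsChain G.Adj) ∧ Ks.flatten.Nodup ∧
      (∀ w, w ∈ Ks.flatten ↔ w ∈ R) ∧ Ks.length + Ls.flatten.length = Ls.length + R.card := by
  set X := (R \ Ls.flatten.toFinset).toList with hX
  have hfl : (X.map fun x => [x]).flatten = X := by
    rw [← List.flatMap_def, List.flatMap_singleton']
  have hmX : ∀ w, w ∈ X ↔ w ∈ R ∧ w ∉ Ls.flatten := by
    intro w
    rw [hX, Finset.mem_toList, Finset.mem_sdiff, List.mem_toFinset]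
  have hsub : Ls.flatten.toFinset ⊆ R := fun w hw => hR w (List.mem_toFinset.1 hw)
  refine ⟨Ls ++ X.map fun x => [x], ?_, ?_, ?_, ?_⟩
  · intro K hK
    rcases List.mem_append.1 hK with hK | hK
    · exact hch K hK
    · obtain ⟨x, _, rfl⟩ := List.mem_map.1 hK
      exact List.isChain_singleton x
  · rw [List.flatten_append, hfl, List.nodup_append]
    refine ⟨hnd, Finset.nodup_toList _, ?_⟩
    rintro a ha b hb rfl
    exact ((hmX a).1 hb).2 ha
  · intro w
    rw [List.flatten_append, hfl, List.mem_append, hmX]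
    have := hR w
    tauto
  · have h1 : X.length = R.card - Ls.flatten.length := by
      rw [hX, Finset.length_toList, Finset.card_sdiff_of_subset hsub,
        List.toFinset_card_of_nodup hnd]
    have h2 : Ls.flatten.length ≤ R.card := by
      rw [← List.toFinset_card_of_nodup hnd]
      exact Finset.card_le_card hsub
    rw [List.length_append, List.length_map, h1]
    omega

/-- A set `R` of at least `d + 2` vertices in which every vertex has at least `d ≥ 1` neighbours
can be covered by `|R| - d - 1` disjoint paths: there is a path on `d + 2` vertices, or a path on
`d + 1` vertices together with a disjoint edge. -/
theorem exists_path_cover {V : Type*} [DecidableEq V] {G : SimpleGraph V}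
    [DecidableRel G.Adj] (R : Finset V) (d : ℕ) (hd : 1 ≤ d) (hcard : d + 2 ≤ R.card)
    (hdeg : ∀ r ∈ R, d ≤ (R.filter fun w => G.Adj r w).card) :
    ∃ Ks : List (List V), (∀ K ∈ Ks, K.IsChain G.Adj) ∧ Ks.flatten.Nodup ∧
      (∀ w, w ∈ Ks.flatten ↔ w ∈ R) ∧ Ks.length + d + 1 ≤ R.card := by
  let good : List V → Prop := fun l => l.Nodup ∧ l.IsChain G.Adj ∧ ∀ w ∈ l, w ∈ R
  have hlen : ∀ l, good l → l.length ≤ R.card := fun l hl => by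
    rw [← List.toFinset_card_of_nodup hl.1]
    exact Finset.card_le_card fun w hw => hl.2.2 w (List.mem_toFinset.1 hw)
  -- a longest path inside `R`
  obtain ⟨l, hl, hmax⟩ : ∃ l, good l ∧ ∀ l', good l' → l'.length ≤ l.length := by
    have hne : {m | ∃ l, good l ∧ l.length = m}.Nonempty := ⟨0, [], by simp [good], rfl⟩
    have hbd : BddAbove {m | ∃ l, good l ∧ l.length = m} := by
      refine ⟨R.card, ?_⟩
      rintro m ⟨l, hl, rfl⟩
      exact hlen l hl
    obtain ⟨l, hl, hlm⟩ := Nat.sSup_mem hne hbd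
    exact ⟨l, hl, fun l' hl' => hlm ▸ le_csSup hbd ⟨l', hl', rfl⟩⟩
  by_cases hlong : d + 2 ≤ l.length
  · obtain ⟨Ks, h1, h2, h3, h4⟩ := exists_cover_extending R [l] (by simpa using hl.2.1)
      (by simpa using hl.1) (by simpa using hl.2.2)
    refine ⟨Ks, h1, h2, h3, ?_⟩
    simp at h4
    omega
  cases l with
  | nil =>
    obtain ⟨r, hr⟩ : R.Nonempty := Finset.card_pos.1 (by omega)
    have := hmax [r] ⟨by simp, by simp, by simpa using hr⟩
    simp at this
  | cons a l =>
  have haR : a ∈ R := hl.2.2 a (by simp)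
  have hnb : ∀ w ∈ R, G.Adj a w → w ∈ l := by
    intro w hw haw
    by_contra hwl
    have := hmax (w :: a :: l) ⟨List.nodup_cons.2 ⟨by simp [haw.ne', hwl], hl.1⟩,
      List.isChain_cons_cons.2 ⟨haw.symm, hl.2.1⟩, by
        intro x hx
        rcases List.mem_cons.1 hx with rfl | hx
        · exact hw
        · exact hl.2.2 x hx⟩
    simp at this
  have hlnd : l.Nodup := hl.1.of_cons
  have hsub : (R.filter fun w => G.Adj a w) ⊆ l.toFinset := fun w hw => by
    rw [Finset.mem_filter] at hw
    exact List.mem_toFinset.2 (hnb w hw.1 hw.2)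
  have hle : l.length ≤ d := by simp at hlong; omega
  have heq : (R.filter fun w => G.Adj a w) = l.toFinset :=
    Finset.eq_of_subset_of_card_le hsub
      ((List.toFinset_card_of_nodup hlnd).le.trans (hle.trans (hdeg a haR)))
  have hlen_l : l.length = d := le_antisymm hle (by
    rw [← List.toFinset_card_of_nodup hlnd, ← heq]; exact hdeg a haR)
  have hall : ∀ w ∈ l, G.Adj a w := fun w hw => by
    have : w ∈ R.filter fun w => G.Adj a w := heq ▸ List.mem_toFinset.2 hw
    exact (Finset.mem_filter.1 this).2
  obtain ⟨w, hwR, hwl⟩ : ∃ w ∈ R, w ∉ (a :: l).toFinset := by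
    refine Finset.exists_mem_notMem_of_card_lt_card ?_
    rw [List.toFinset_card_of_nodup hl.1, List.length_cons]
    omega
  rw [List.mem_toFinset] at hwl
  obtain ⟨z, hz⟩ : (R.filter fun z => G.Adj w z).Nonempty :=
    Finset.card_pos.1 (hd.trans (hdeg w hwR))
  rw [Finset.mem_filter] at hz
  obtain ⟨hzR, hwz⟩ := hz
  by_cases hzl : z ∈ a :: l
  · -- since `a` sees the whole path, the path can be rerouted to end in `z`, then `w` is appended
    exfalso
    obtain ⟨A, B, hAB⟩ := List.append_of_mem hzl
    have hc := hl.2.1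
    rw [hAB] at hc
    have hc := List.isChain_split.1 hc
    have hh : (A ++ [z]).head? = some a := by
      have := congrArg List.head? hAB
      cases A <;> simp_all
    have hperm : (w :: ((A ++ [z]).reverse ++ B)).Perm (w :: a :: l) := by
      refine List.Perm.cons w ?_
      rw [hAB]
      simpa using (List.reverse_perm (A ++ [z])).append_right B
    have hBl : ∀ b ∈ B, G.Adj a b := by
      intro b hb
      refine hall b ?_
      cases A with
      | nil => simp at hAB; rw [hAB.2]; exact hb
      | cons c A => simp at hAB; rw [hAB.2]; simp [hb]
    have := hmax (w :: ((A ++ [z]).reverse ++ B)) ⟨hperm.nodup_iff.2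
      (List.nodup_cons.2 ⟨hwl, hl.1⟩), ?_, ?_⟩
    · have h := hperm.length_eq
      simp at this h
      omega
    · refine List.isChain_cons.2 ⟨?_, List.isChain_append.2
        ⟨isChain_reverse hc.1, hc.2.of_cons, ?_⟩⟩
      · intro y hy
        simp at hy
        exact hy ▸ hwz
      · intro x hx y hy
        rw [List.getLast?_reverse, hh] at hx
        simp at hx
        exact hx ▸ hBl y (List.mem_of_head? hy)
    · intro x hx
      rcases List.mem_cons.1 (hperm.mem_iff.1 hx) with rfl | hx
      · exact hwR
      · exact hl.2.2 x hx
  · obtain ⟨Ks, h1, h2, h3, h4⟩ := exists_cover_extending (G := G) R [a :: l, [w, z]]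
      (by
        intro L hL
        simp at hL
        rcases hL with rfl | rfl
        · exact hl.2.1
        · simpa using hwz)
      (by
        have e : [a :: l, [w, z]].flatten = (a :: l) ++ [w, z] := by simp
        rw [e, List.nodup_append]
        refine ⟨hl.1, by simpa using hwz.ne, ?_⟩
        rintro x hx y hy rfl
        simp only [List.mem_cons, List.not_mem_nil, or_false] at hy
        rcases hy with rfl | rfl
        · exact hwl hx
        · exact hzl hx)
      (by
        intro x hx
        have e : [a :: l, [w, z]].flatten = (a :: l) ++ [w, z] := by simp
        rw [e, List.mem_append] at hx
        rcases hx with hx | hx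
        · exact hl.2.2 x hx
        · simp only [List.mem_cons, List.not_mem_nil, or_false] at hx
          rcases hx with rfl | rfl
          · exact hwR
          · exact hzR)
    refine ⟨Ks, h1, h2, h3, ?_⟩
    simp at h4
    omega

/-! ### An edge bound from the signless Laplacian spectral radius -/

theorem signlessLaplacian_toLin'_apply {V : Type*} [Fintype V] [DecidableEq V]
    (G : SimpleGraph V) [DecidableRel G.Adj] (x : V → ℝ) (u : V) :
    Matrix.toLin' (signlessLaplacian G) x u =
      G.degree u * x u + ∑ v ∈ G.neighborFinset u, x v := by
  rw [Matrix.toLin'_apply, signlessLaplacian, Matrix.add_mulVec, Pi.add_apply,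
    Matrix.mulVec_diagonal, SimpleGraph.adjMatrix_mulVec_apply]

theorem exists_eigenvector_q {V : Type*} [Fintype V] [DecidableEq V] [Nonempty V]
    (G : SimpleGraph V) [DecidableRel G.Adj] :
    ∃ x : V → ℝ, x ≠ 0 ∧ ∀ u, q G * x u = G.degree u * x u + ∑ v ∈ G.neighborFinset u, x v := by
  obtain ⟨x, hx⟩ := (isGreatest_q G).1.exists_hasEigenvector
  refine ⟨x, hx.2, fun u => ?_⟩
  rw [← signlessLaplacian_toLin'_apply, hx.apply_eq_smul]
  rfl

/-- The spectral radius is at most `d(u) + (∑_{v ~ u} d(v)) / d(u)` for some vertex `u`: compare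
an eigenvector with the degree vector. -/
theorem exists_q_le {V : Type*} [Fintype V] [DecidableEq V] [Nonempty V]
    (G : SimpleGraph V) [DecidableRel G.Adj] (hd : ∀ v, 0 < G.degree v) :
    ∃ u, q G ≤ G.degree u + (∑ v ∈ G.neighborFinset u, (G.degree v : ℝ)) / G.degree u := by
  obtain ⟨x, hx0, hx⟩ := exists_eigenvector_q G
  have hd' : ∀ v, (0 : ℝ) < G.degree v := fun v => by exact_mod_cast hd v
  obtain ⟨u, -, hu⟩ := Finset.exists_max_image Finset.univ (fun v => |x v| / G.degree v)
    Finset.univ_nonempty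
  have hle : ∀ v, |x v| ≤ |x u| / G.degree u * G.degree v := fun v =>
    (div_le_iff₀ (hd' v)).1 (hu v (Finset.mem_univ v))
  have hpos : 0 < |x u| := by
    rw [abs_pos]
    intro h0
    refine hx0 (funext fun v => ?_)
    have := hle v
    rw [h0] at this
    simpa using this
  refine ⟨u, ?_⟩
  have h1 : q G * |x u| ≤ |q G * x u| := by
    rw [abs_mul]
    exact mul_le_mul_of_nonneg_right (le_abs_self _) (abs_nonneg _)
  have h2 : |q G * x u| ≤ G.degree u * |x u| +
      ∑ v ∈ G.neighborFinset u, |x u| / G.degree u * G.degree v := by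
    rw [hx u]
    refine (abs_add_le _ _).trans (add_le_add ?_ ?_)
    · rw [abs_mul, abs_of_pos (hd' u)]
    · exact (Finset.abs_sum_le_sum_abs _ _).trans (Finset.sum_le_sum fun v _ => hle v)
  rw [← Finset.mul_sum] at h2
  have h3 : q G * |x u| ≤ (G.degree u + (∑ v ∈ G.neighborFinset u, (G.degree v : ℝ)) /
      G.degree u) * |x u| := by
    refine (h1.trans h2).trans (le_of_eq ?_)
    ring
  exact le_of_mul_le_mul_right h3 hpos

/-- `(n - 1) q(G) ≤ 2 e(G) + (n - 1)(n - 2)` for a graph without isolated vertices. -/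
theorem q_mul_le {V : Type*} [Fintype V] [DecidableEq V] [Nonempty V]
    (G : SimpleGraph V) [DecidableRel G.Adj] (hd : ∀ v, 0 < G.degree v) :
    q G * (Fintype.card V - 1) ≤
      ∑ v, (G.degree v : ℝ) + (Fintype.card V - 1) * (Fintype.card V - 2) := by
  obtain ⟨u, hu⟩ := exists_q_le G hd
  set n : ℝ := (Fintype.card V : ℝ) with hn
  have hle : ∀ v, (G.degree v : ℝ) ≤ n - 1 := fun v => by
    have : G.degree v + 1 ≤ Fintype.card V := G.degree_lt_card_verts v
    have : (G.degree v : ℝ) + 1 ≤ n := by rw [hn]; exact_mod_cast this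
    linarith
  set d : ℝ := (G.degree u : ℝ) with hd_def
  have hdpos : 0 < d := by rw [hd_def]; exact_mod_cast hd u
  set s : ℝ := ∑ v ∈ G.neighborFinset u, (G.degree v : ℝ) with hs
  have hs_le : s ≤ d * (n - 1) := by
    refine (Finset.sum_le_card_nsmul _ _ (n - 1) fun v _ => hle v).trans (le_of_eq ?_)
    rw [G.card_neighborFinset_eq_degree, nsmul_eq_mul]
  have hsum : d + s + (n - 1 - d) ≤ ∑ v, (G.degree v : ℝ) := by
    have hu' : u ∉ G.neighborFinset u := by simp
    rw [← Finset.sum_add_sum_compl (insert u (G.neighborFinset u)), Finset.sum_insert hu']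
    have : ((insert u (G.neighborFinset u))ᶜ.card : ℝ) ≤
        ∑ v ∈ (insert u (G.neighborFinset u))ᶜ, (G.degree v : ℝ) := by
      rw [Finset.card_eq_sum_ones]
      push_cast
      exact Finset.sum_le_sum fun v _ => by exact_mod_cast hd v
    rw [Finset.card_compl, Finset.card_insert_of_notMem hu', G.card_neighborFinset_eq_degree,
      Nat.cast_sub (by have := G.degree_lt_card_verts u; omega)] at this
    push_cast at this
    linarith
  have hn1 : 0 ≤ n - 1 := hdpos.le.trans (hle u)
  have h1 : s / d ≤ n - 1 := by rw [div_le_iff₀ hdpos]; linarith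
  have h2 : s / d * d = s := div_mul_cancel₀ s hdpos.ne'
  have h3 : q G * (n - 1) ≤ (d + s / d) * (n - 1) := mul_le_mul_of_nonneg_right hu hn1
  have h4 : s / d * (n - 1 - d) ≤ (n - 1) * (n - 1 - d) :=
    mul_le_mul_of_nonneg_right h1 (by linarith [hle u])
  nlinarith

/-! ### The quadratic form of an almost complete graph with few pendant edges -/

/-- Twice the quadratic form of the signless Laplacian, as a sum over ordered pairs. -/
theorem exists_quadForm_eq {V : Type*} [Fintype V] [DecidableEq V] [Nonempty V]
    (G : SimpleGraph V) [DecidableRel G.Adj] :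
    ∃ x : V → ℝ, 0 < ∑ v, x v ^ 2 ∧
      2 * q G * ∑ v, x v ^ 2 = ∑ u, ∑ v, (if G.Adj u v then (1 : ℝ) else 0) * (x u + x v) ^ 2 := by
  obtain ⟨x, hx0, hx⟩ := exists_eigenvector_q G
  refine ⟨x, ?_, ?_⟩
  · obtain ⟨v, hv⟩ := Function.ne_iff.1 hx0
    exact Finset.sum_pos' (fun _ _ => sq_nonneg _)
      ⟨v, Finset.mem_univ v, by have : x v ≠ 0 := hv; positivity⟩
  · have hdeg : ∀ u, (G.degree u : ℝ) = ∑ v, if G.Adj u v then (1 : ℝ) else 0 := fun u =>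
      G.degree_eq_sum_if_adj u
    have hnb : ∀ u, ∑ v ∈ G.neighborFinset u, x v =
        ∑ v, (if G.Adj u v then (1 : ℝ) else 0) * x v := fun u => by
      rw [SimpleGraph.neighborFinset_eq_filter, Finset.sum_filter]
      exact Finset.sum_congr rfl fun v _ => by split_ifs <;> simp
    have h1 : q G * ∑ v, x v ^ 2 = ∑ u, ∑ v, (if G.Adj u v then (1 : ℝ) else 0) * x u ^ 2 +
        ∑ u, ∑ v, (if G.Adj u v then (1 : ℝ) else 0) * (x u * x v) := by
      rw [Finset.mul_sum, ← Finset.sum_add_distrib]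
      refine Finset.sum_congr rfl fun u _ => ?_
      have := hx u
      rw [hdeg, hnb] at this
      rw [pow_two, ← mul_assoc, this, add_mul, Finset.sum_mul, Finset.sum_mul, Finset.sum_mul]
      congr 1 <;> refine Finset.sum_congr rfl fun v _ => ?_ <;> ring
    have h2 : ∑ u, ∑ v, (if G.Adj u v then (1 : ℝ) else 0) * x v ^ 2 =
        ∑ u, ∑ v, (if G.Adj u v then (1 : ℝ) else 0) * x u ^ 2 := by
      rw [Finset.sum_comm]
      simp only [G.adj_comm]
    have h3 : ∑ u, ∑ v, (if G.Adj u v then (1 : ℝ) else 0) * (x u + x v) ^ 2 =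
        ∑ u, ∑ v, (if G.Adj u v then (1 : ℝ) else 0) * x u ^ 2 +
        2 * ∑ u, ∑ v, (if G.Adj u v then (1 : ℝ) else 0) * (x u * x v) +
        ∑ u, ∑ v, (if G.Adj u v then (1 : ℝ) else 0) * x v ^ 2 := by
      simp only [Finset.mul_sum, ← Finset.sum_add_distrib]
      exact Finset.sum_congr rfl fun u _ => Finset.sum_congr rfl fun v _ => by ring
    rw [h3, h2, mul_assoc, h1]
    ring

set_option maxHeartbeats 1000000 in
/-- The quadratic form estimate. `A` is an adjacency matrix and `F` a matrix of pairs inside `W`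
that are absent from `A`; `c` is the number of edges between `W` and its complement, `t` the number
of edges of `F`. Splitting `x` on `W` into its mean `m` and a remainder, the terms in `m ^ 2`
contribute `(c - 4 t) m ^ 2 < 0` beyond the form of the complete graph on `W`, and all mixed terms
are absorbed by the spectral gap of that complete graph. -/
theorem quadForm_lt {V : Type*} [Fintype V] [DecidableEq V] (W : Finset V) (A F : V → V → ℝ)
    (x : V → ℝ) (k c t N : ℝ) (hA0 : ∀ u v, 0 ≤ A u v) (hAs : ∀ u v, A u v = A v u)
    (hF0 : ∀ u v, 0 ≤ F u v) (hFs : ∀ u v, F u v = F v u)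
    (hAF : ∀ u v, A u v + F u v + (if u = v then 1 else 0) ≤ 1)
    (hk : 1 ≤ k) (hN : (W.card : ℝ) = N)
    (ha : ∀ w ∈ W, ∑ r ∈ Wᶜ, A w r ≤ k - 1) (hd : ∀ r ∈ Wᶜ, ∑ w ∈ W, A w r ≤ k)
    (hc : ∑ w ∈ W, ∑ r ∈ Wᶜ, A w r = c) (he : ∀ w ∈ W, ∑ v ∈ W, F w v ≤ t)
    (ht : ∑ w ∈ W, ∑ v ∈ W, F w v = 2 * t) (hdR : ∀ r ∈ Wᶜ, ∑ s ∈ Wᶜ, A r s ≤ k)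
    (htc : c + 2 ≤ 4 * t) (htc' : 4 * t ≤ c + 4)
    (hN1 : 2 * (2 * k - 1) * c + (c + 4) ^ 2 < N) (hN2 : 8 * k + 4 ≤ N)
    (hx : 0 < ∑ v, x v ^ 2) :
    ∑ u, ∑ v, A u v * (x u + x v) ^ 2 < 4 * (N - 1) * ∑ v, x v ^ 2 := by
  have hNpos : 0 < N := by linarith
  set m : ℝ := (∑ w ∈ W, x w) / N with hm
  set y : V → ℝ := fun w => x w - m with hy
  set a : V → ℝ := fun w => ∑ r ∈ Wᶜ, A w r with ha_def
  set d : V → ℝ := fun r => ∑ w ∈ W, A w r with hd_def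
  set e : V → ℝ := fun w => ∑ v ∈ W, F w v with he_def
  set Y2 : ℝ := ∑ w ∈ W, y w ^ 2 with hY2
  set X2 : ℝ := ∑ r ∈ Wᶜ, x r ^ 2 with hX2
  have hxy : ∀ w, x w = m + y w := fun w => by simp [hy]
  have hsx : ∑ w ∈ W, x w = N * m := by rw [hm]; field_simp
  have hsy : ∑ w ∈ W, y w = 0 := by
    simp only [hy, Finset.sum_sub_distrib, Finset.sum_const, nsmul_eq_mul, hN, hsx, sub_self]
  have hsx2 : ∑ w ∈ W, x w ^ 2 = N * m ^ 2 + Y2 := by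
    have : ∀ w, x w ^ 2 = m ^ 2 + 2 * m * y w + y w ^ 2 := fun w => by rw [hxy]; ring
    simp only [this, Finset.sum_add_distrib, Finset.sum_const, nsmul_eq_mul, hN, ← Finset.mul_sum,
      hsy]
    ring
  have hS : ∑ v, x v ^ 2 = N * m ^ 2 + Y2 + X2 := by
    rw [← Finset.sum_add_sum_compl W, hsx2]
  have ha0 : ∀ w, 0 ≤ a w := fun w => Finset.sum_nonneg fun _ _ => hA0 _ _
  have hd0 : ∀ r, 0 ≤ d r := fun r => Finset.sum_nonneg fun _ _ => hA0 _ _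
  have he0 : ∀ w, 0 ≤ e w := fun w => Finset.sum_nonneg fun _ _ => hF0 _ _
  have hdc : ∑ r ∈ Wᶜ, d r = c := by rw [hd_def, Finset.sum_comm, hc]
  have hc0 : 0 ≤ c := by rw [← hc]; exact Finset.sum_nonneg fun w _ => ha0 w
  -- the four blocks of the sum over ordered pairs
  have hsplit : ∑ u, ∑ v, A u v * (x u + x v) ^ 2 =
      ∑ u ∈ W, ∑ v ∈ W, A u v * (x u + x v) ^ 2 +
      2 * ∑ u ∈ W, ∑ v ∈ Wᶜ, A u v * (x u + x v) ^ 2 +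
      ∑ u ∈ Wᶜ, ∑ v ∈ Wᶜ, A u v * (x u + x v) ^ 2 := by
    have h1 : ∑ u ∈ Wᶜ, ∑ v ∈ W, A u v * (x u + x v) ^ 2 =
        ∑ u ∈ W, ∑ v ∈ Wᶜ, A u v * (x u + x v) ^ 2 := by
      rw [Finset.sum_comm]
      exact Finset.sum_congr rfl fun u _ => Finset.sum_congr rfl fun v _ => by
        rw [hAs, add_comm]
    have h2 : ∀ u, ∑ v, A u v * (x u + x v) ^ 2 = ∑ v ∈ W, A u v * (x u + x v) ^ 2 +
        ∑ v ∈ Wᶜ, A u v * (x u + x v) ^ 2 := fun u => (Finset.sum_add_sum_compl W _).symm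
    rw [← Finset.sum_add_sum_compl W]
    simp only [h2, Finset.sum_add_distrib]
    rw [h1]
    ring
  have hWW : ∑ u ∈ W, ∑ v ∈ W, A u v * (x u + x v) ^ 2 ≤
      4 * (N - 1) * N * m ^ 2 + (2 * N - 4) * Y2 -
        ∑ u ∈ W, ∑ v ∈ W, F u v * (x u + x v) ^ 2 := by
    have h1 : ∑ u ∈ W, ∑ v ∈ W, (x u + x v) ^ 2 =
        2 * N * (N * m ^ 2 + Y2) + 2 * (N * m) ^ 2 := by
      have : ∀ u v, (x u + x v) ^ 2 = x u ^ 2 + 2 * x u * x v + x v ^ 2 := fun u v => by ring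
      simp only [this, Finset.sum_add_distrib, Finset.sum_const, nsmul_eq_mul, hN, ← Finset.mul_sum,
        hsx2, hsx, ← Finset.sum_mul]
      ring
    have h2 : ∑ u ∈ W, ∑ v ∈ W, (if u = v then (1 : ℝ) else 0) * (x u + x v) ^ 2 =
        4 * (N * m ^ 2 + Y2) := by
      rw [← hsx2, Finset.mul_sum]
      refine Finset.sum_congr rfl fun u hu => ?_
      simp only [ite_mul, one_mul, zero_mul, Finset.sum_ite_eq, hu, if_true]
      ring
    have h3 : ∑ u ∈ W, ∑ v ∈ W, A u v * (x u + x v) ^ 2 +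
        ∑ u ∈ W, ∑ v ∈ W, F u v * (x u + x v) ^ 2 +
        ∑ u ∈ W, ∑ v ∈ W, (if u = v then (1 : ℝ) else 0) * (x u + x v) ^ 2 ≤
        ∑ u ∈ W, ∑ v ∈ W, (x u + x v) ^ 2 := by
      simp only [← Finset.sum_add_distrib]
      refine Finset.sum_le_sum fun u _ => Finset.sum_le_sum fun v _ => ?_
      rw [← add_mul, ← add_mul]
      exact mul_le_of_le_one_left (sq_nonneg _) (hAF u v)
    rw [h1, h2] at h3
    linarith
  have hFF : 8 * t * m ^ 2 + 8 * m * ∑ w ∈ W, e w * y w ≤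
      ∑ u ∈ W, ∑ v ∈ W, F u v * (x u + x v) ^ 2 := by
    have h1 : ∑ u ∈ W, ∑ v ∈ W, F u v * (4 * m ^ 2 + 4 * m * (y u + y v)) ≤
        ∑ u ∈ W, ∑ v ∈ W, F u v * (x u + x v) ^ 2 := by
      refine Finset.sum_le_sum fun u _ => Finset.sum_le_sum fun v _ =>
        mul_le_mul_of_nonneg_left ?_ (hF0 u v)
      rw [hxy u, hxy v]
      linarith [sq_nonneg (y u + y v)]
    have h2 : ∑ u ∈ W, ∑ v ∈ W, F u v * y v = ∑ w ∈ W, e w * y w := by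
      rw [Finset.sum_comm]
      refine Finset.sum_congr rfl fun u _ => ?_
      rw [he_def, Finset.sum_mul]
      exact Finset.sum_congr rfl fun v _ => by rw [hFs]
    have h3 : ∑ u ∈ W, ∑ v ∈ W, F u v * y u = ∑ w ∈ W, e w * y w :=
      Finset.sum_congr rfl fun u _ => by rw [he_def, Finset.sum_mul]
    have h4 : ∑ u ∈ W, ∑ v ∈ W, F u v * (4 * m ^ 2 + 4 * m * (y u + y v)) =
        4 * m ^ 2 * ∑ u ∈ W, ∑ v ∈ W, F u v + 4 * m * ∑ u ∈ W, ∑ v ∈ W, F u v * y u +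
          4 * m * ∑ u ∈ W, ∑ v ∈ W, F u v * y v := by
      simp only [Finset.mul_sum, ← Finset.sum_add_distrib]
      exact Finset.sum_congr rfl fun u _ => Finset.sum_congr rfl fun v _ => by ring
    rw [h4, h2, h3, ht] at h1
    linarith
  have hWR : ∑ u ∈ W, ∑ v ∈ Wᶜ, A u v * (x u + x v) ^ 2 ≤
      c * m ^ 2 + 2 * m * (∑ w ∈ W, a w * y w + ∑ r ∈ Wᶜ, d r * x r) +
        2 * ∑ w ∈ W, a w * y w ^ 2 + 2 * ∑ r ∈ Wᶜ, d r * x r ^ 2 := by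
    have g1 : ∀ f : V → ℝ, ∑ u ∈ W, ∑ v ∈ Wᶜ, A u v * f u = ∑ w ∈ W, a w * f w := fun f =>
      Finset.sum_congr rfl fun u _ => by rw [ha_def, Finset.sum_mul]
    have g2 : ∀ f : V → ℝ, ∑ u ∈ W, ∑ v ∈ Wᶜ, A u v * f v = ∑ r ∈ Wᶜ, d r * f r := fun f => by
      rw [Finset.sum_comm]
      exact Finset.sum_congr rfl fun u _ => by rw [hd_def, Finset.sum_mul]
    have h1 : ∑ u ∈ W, ∑ v ∈ Wᶜ, A u v * (x u + x v) ^ 2 ≤ ∑ u ∈ W, ∑ v ∈ Wᶜ,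
        (m ^ 2 * A u v + 2 * m * (A u v * y u) + 2 * m * (A u v * x v) + 2 * (A u v * y u ^ 2) +
          2 * (A u v * x v ^ 2)) := by
      refine Finset.sum_le_sum fun u _ => Finset.sum_le_sum fun v _ => ?_
      have : (x u + x v) ^ 2 ≤ m ^ 2 + 2 * m * y u + 2 * m * x v + 2 * y u ^ 2 + 2 * x v ^ 2 := by
        rw [hxy u]
        linarith [sq_nonneg (y u - x v)]
      linarith [mul_le_mul_of_nonneg_left this (hA0 u v)]
    simp only [Finset.sum_add_distrib, ← Finset.mul_sum] at h1
    rw [hc, g1 y, g1 fun w => y w ^ 2, g2 x, g2 fun w => x w ^ 2] at h1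
    linarith
  have hRR : ∑ u ∈ Wᶜ, ∑ v ∈ Wᶜ, A u v * (x u + x v) ^ 2 ≤ 4 * k * X2 := by
    have h1 : ∑ u ∈ Wᶜ, ∑ v ∈ Wᶜ, A u v * (x u + x v) ^ 2 ≤
        ∑ u ∈ Wᶜ, ∑ v ∈ Wᶜ, (2 * (A u v * x u ^ 2) + 2 * (A u v * x v ^ 2)) := by
      refine Finset.sum_le_sum fun u _ => Finset.sum_le_sum fun v _ => ?_
      have : (x u + x v) ^ 2 ≤ 2 * x u ^ 2 + 2 * x v ^ 2 := by linarith [sq_nonneg (x u - x v)]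
      linarith [mul_le_mul_of_nonneg_left this (hA0 u v)]
    have h2 : ∑ u ∈ Wᶜ, ∑ v ∈ Wᶜ, A u v * x u ^ 2 ≤ k * X2 := by
      rw [hX2, Finset.mul_sum]
      refine Finset.sum_le_sum fun u hu => ?_
      rw [← Finset.sum_mul]
      exact mul_le_mul_of_nonneg_right (hdR u hu) (sq_nonneg _)
    have h3 : ∑ u ∈ Wᶜ, ∑ v ∈ Wᶜ, A u v * x v ^ 2 = ∑ u ∈ Wᶜ, ∑ v ∈ Wᶜ, A u v * x u ^ 2 := by
      rw [Finset.sum_comm]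
      exact Finset.sum_congr rfl fun u _ => Finset.sum_congr rfl fun v _ => by rw [hAs]
    simp only [Finset.sum_add_distrib, ← Finset.mul_sum] at h1
    rw [h3] at h1
    linarith
  have hay : ∑ w ∈ W, a w * y w ^ 2 ≤ (k - 1) * Y2 := by
    rw [hY2, Finset.mul_sum]
    exact Finset.sum_le_sum fun w hw => mul_le_mul_of_nonneg_right (ha w hw) (sq_nonneg _)
  have hdx : ∑ r ∈ Wᶜ, d r * x r ^ 2 ≤ k * X2 := by
    rw [hX2, Finset.mul_sum]
    exact Finset.sum_le_sum fun w hw => mul_le_mul_of_nonneg_right (hd w hw) (sq_nonneg _)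
  -- mixed terms, by the inequality of arithmetic and geometric means
  have amgm : ∀ b z : ℝ, 4 * m * (b * z) ≤ N / 2 * z ^ 2 + 8 / N * m ^ 2 * b ^ 2 := by
    intro b z
    have : N / 2 * z ^ 2 + 8 / N * m ^ 2 * b ^ 2 - 4 * m * (b * z) =
        (N * z - 4 * m * b) ^ 2 / (2 * N) := by
      field_simp
      ring
    have h2 : 0 ≤ (N * z - 4 * m * b) ^ 2 / (2 * N) := by positivity
    linarith
  have hmix1 : 4 * m * (∑ w ∈ W, a w * y w - 2 * ∑ w ∈ W, e w * y w) ≤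
      N / 2 * Y2 + 8 / N * m ^ 2 * ((k - 1) * c + 8 * t ^ 2) := by
    have h1 : ∑ w ∈ W, a w * y w - 2 * ∑ w ∈ W, e w * y w =
        ∑ w ∈ W, (a w - 2 * e w) * y w := by
      rw [Finset.mul_sum, ← Finset.sum_sub_distrib]
      exact Finset.sum_congr rfl fun w _ => by ring
    have h2 : ∑ w ∈ W, (a w - 2 * e w) ^ 2 ≤ (k - 1) * c + 8 * t ^ 2 := by
      have : ∑ w ∈ W, (a w - 2 * e w) ^ 2 ≤ ∑ w ∈ W, ((k - 1) * a w + 4 * t * e w) := by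
        refine Finset.sum_le_sum fun w hw => ?_
        have p1 : a w * a w ≤ (k - 1) * a w := mul_le_mul_of_nonneg_right (ha w hw) (ha0 w)
        have p2 : e w * e w ≤ t * e w := mul_le_mul_of_nonneg_right (he w hw) (he0 w)
        linarith [mul_nonneg (ha0 w) (he0 w)]
      rw [Finset.sum_add_distrib, ← Finset.mul_sum, ← Finset.mul_sum, ht, hc] at this
      linarith
    rw [h1, Finset.mul_sum]
    refine (Finset.sum_le_sum fun w _ => amgm (a w - 2 * e w) (y w)).trans ?_
    rw [Finset.sum_add_distrib, ← Finset.mul_sum, ← Finset.mul_sum]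
    have : 0 ≤ 8 / N * m ^ 2 := by positivity
    linarith [mul_le_mul_of_nonneg_left h2 this]
  have hmix2 : 4 * m * ∑ r ∈ Wᶜ, d r * x r ≤ N / 2 * X2 + 8 / N * m ^ 2 * (k * c) := by
    have h2 : ∑ r ∈ Wᶜ, d r ^ 2 ≤ k * c := by
      rw [← hdc, Finset.mul_sum]
      refine Finset.sum_le_sum fun r hr => ?_
      rw [pow_two]
      exact mul_le_mul_of_nonneg_right (hd r hr) (hd0 r)
    rw [Finset.mul_sum]
    refine (Finset.sum_le_sum fun r _ => amgm (d r) (x r)).trans ?_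
    rw [Finset.sum_add_distrib, ← Finset.mul_sum, ← Finset.mul_sum]
    have : 0 ≤ 8 / N * m ^ 2 := by positivity
    linarith [mul_le_mul_of_nonneg_left h2 this]
  have hY0 : 0 ≤ Y2 := Finset.sum_nonneg fun _ _ => sq_nonneg _
  have hX0 : 0 ≤ X2 := Finset.sum_nonneg fun _ _ => sq_nonneg _
  -- the coefficient of `m ^ 2` is negative
  have hcoef : 8 / N * ((k - 1) * c + 8 * t ^ 2) + 8 / N * (k * c) < 4 := by
    have h1 : 8 * t ^ 2 ≤ (c + 4) ^ 2 / 2 := by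
      have : (4 * t) ^ 2 ≤ (c + 4) ^ 2 := pow_le_pow_left₀ (by linarith) htc' 2
      linarith
    have h2 : 8 / N * ((k - 1) * c + 8 * t ^ 2) + 8 / N * (k * c) =
        8 * ((2 * k - 1) * c + 8 * t ^ 2) / N := by ring
    rw [h2, div_lt_iff₀ hNpos]
    linarith
  have hdiff : ∑ u, ∑ v, A u v * (x u + x v) ^ 2 ≤ 4 * (N - 1) * (N * m ^ 2 + Y2 + X2) -
      ((4 - (8 / N * ((k - 1) * c + 8 * t ^ 2) + 8 / N * (k * c))) * m ^ 2 +
        (3 * N / 2 + 4 - 4 * k) * Y2 + (7 * N / 2 - 4 - 8 * k) * X2) := by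
    have h8 : (8 * t - 2 * c) * m ^ 2 ≥ 4 * m ^ 2 :=
      mul_le_mul_of_nonneg_right (by linarith) (sq_nonneg m)
    rw [hsplit]
    linarith
  rw [hS]
  refine lt_of_le_of_lt hdiff (sub_lt_self _ ?_)
  rw [hS] at hx
  have k1 := sub_pos.2 hcoef
  have k2 : 0 < 3 * N / 2 + 4 - 4 * k := by linarith
  have k3 : 0 < 7 * N / 2 - 4 - 8 * k := by linarith
  by_contra hneg
  have q1 := mul_nonneg k1.le (sq_nonneg m)
  have q2 := mul_nonneg k2.le hY0
  have q3 := mul_nonneg k3.le hX0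
  have z1 : m ^ 2 = 0 := (mul_eq_zero.1 (by linarith : _ * m ^ 2 = 0)).resolve_left k1.ne'
  have z2 : Y2 = 0 := (mul_eq_zero.1 (by linarith : _ * Y2 = 0)).resolve_left k2.ne'
  have z3 : X2 = 0 := (mul_eq_zero.1 (by linarith : _ * X2 = 0)).resolve_left k3.ne'
  rw [z1, z2, z3] at hx
  simp at hx

/-- Let all vertices outside a set `W` of `n - k + 1` vertices have exactly `s ≤ k` neighbours in
`W`, so that `c = (k - 1) s` edges leave `W`. If a set `D` of nonadjacent pairs in `W` satisfies
`c + 2 ≤ 4 |D| ≤ c + 4`, then `q(G) < 2 (n - k)`. The upper bound on `|D|` loses nothing, as a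
larger set can be shrunk. -/
theorem q_lt_of_missing_edges {V : Type*} [Fintype V] [DecidableEq V] [Nonempty V]
    (G : SimpleGraph V) [DecidableRel G.Adj] {n k s : ℕ} (hk : 2 ≤ k) (hV : Fintype.card V = n)
    (hn : k ^ 4 + 5 * k ^ 3 + 2 * k ^ 2 + 8 * k + 12 ≤ n) (W : Finset V)
    (hW : W.card + k = n + 1) (hs : s ≤ k)
    (hWs : ∀ r ∉ W, (W.filter fun w => G.Adj r w).card = s) (D : Finset (Sym2 V))
    (hDG : ∀ e ∈ D, e ∉ G.edgeSet) (hDd : ∀ e ∈ D, ¬ e.IsDiag) (hDW : ∀ e ∈ D, ∀ v ∈ e, v ∈ W)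
    (hD : (k - 1) * s + 2 ≤ 4 * D.card) (hD' : 4 * D.card ≤ (k - 1) * s + 4) :
    q G < 2 * (n : ℝ) - 2 * k := by
  classical
  obtain ⟨x, hx0, hx⟩ := exists_quadForm_eq G
  obtain ⟨F, hF⟩ : ∃ F : SimpleGraph V, F = SimpleGraph.fromEdgeSet (D : Set (Sym2 V)) := ⟨_, rfl⟩
  have hFadj : ∀ u v, F.Adj u v ↔ s(u, v) ∈ D := fun u v => by
    rw [hF, SimpleGraph.fromEdgeSet_adj]
    refine ⟨fun h => by simpa using h.1, fun h => ⟨by simpa using h, fun huv => ?_⟩⟩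
    exact hDd _ h (by simp [huv])
  have hFW : ∀ u v, F.Adj u v → u ∈ W := fun u v h =>
    hDW _ ((hFadj u v).1 h) u (by simp)
  have hFcard : F.edgeFinset.card = D.card := by
    congr 1
    ext e
    rw [SimpleGraph.mem_edgeFinset]
    induction e with
    | _ u v => rw [SimpleGraph.mem_edgeSet, hFadj]
  have hWc : Wᶜ.card + 1 = k := by
    rw [Finset.card_compl, hV]
    have := Finset.card_le_univ W
    omega
  have hWcR : (Wᶜ.card : ℝ) = k - 1 := by
    rw [← hWc]; push_cast; ring
  have hsumF : ∀ w, ∑ v ∈ W, (if F.Adj w v then (1 : ℝ) else 0) = F.degree w := by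
    intro w
    rw [F.degree_eq_sum_if_adj (R := ℝ) w, ← Finset.sum_add_sum_compl W]
    refine (add_eq_left.2 (Finset.sum_eq_zero fun v hv => ?_)).symm
    rw [if_neg]
    exact fun h => Finset.mem_compl.1 hv (hFW v w h.symm)
  have hone : ∀ (P : Prop) [Decidable P], (if P then (1 : ℝ) else 0) ≤ 1 := fun P _ => by
    split_ifs <;> norm_num
  have hds : ∀ r ∈ Wᶜ, ∑ w ∈ W, (if G.Adj w r then (1 : ℝ) else 0) = s := by
    intro r hr
    rw [← hWs r (Finset.mem_compl.1 hr), Finset.sum_boole]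
    simp only [G.adj_comm]
  have hsR : (s : ℝ) ≤ k := by exact_mod_cast hs
  have hkR : (2 : ℝ) ≤ k := by exact_mod_cast hk
  have hs0 : (0 : ℝ) ≤ s := by positivity
  have hnR : (k : ℝ) ^ 4 + 5 * k ^ 3 + 2 * k ^ 2 + 8 * k + 12 ≤ n := by exact_mod_cast hn
  have hWR : (W.card : ℝ) = n - k + 1 := by
    have : (W.card : ℝ) + k = n + 1 := by exact_mod_cast hW
    linarith
  have hk1 : ((k - 1 : ℕ) : ℝ) = k - 1 := by
    rw [Nat.cast_sub (by omega)]; simp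
  have hDR : ((k : ℝ) - 1) * s + 2 ≤ 4 * D.card := by
    rw [← hk1]; exact_mod_cast hD
  have hDR' : 4 * (D.card : ℝ) ≤ ((k : ℝ) - 1) * s + 4 := by
    rw [← hk1]; exact_mod_cast hD'
  have hc : ((k : ℝ) - 1) * s ≤ (k - 1) * k := mul_le_mul_of_nonneg_left hsR (by linarith)
  have hc0 : 0 ≤ ((k : ℝ) - 1) * s := mul_nonneg (by linarith) hs0
  have key := quadForm_lt W (fun u v => if G.Adj u v then 1 else 0)
    (fun u v => if F.Adj u v then 1 else 0) x k ((k - 1) * s) D.card (n - k + 1)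
    (fun u v => by positivity) (fun u v => by simp only [G.adj_comm])
    (fun u v => by positivity) (fun u v => by simp only [F.adj_comm])
    (by
      intro u v
      by_cases huv : u = v
      · subst huv; simp
      · by_cases h1 : F.Adj u v
        · have : ¬ G.Adj u v := fun h => hDG _ ((hFadj u v).1 h1) h
          simp [huv, h1, this]
        · simp only [huv, h1, if_false, add_zero]; exact hone _)
    (by linarith) hWR
    (fun w _ => by
      rw [← hWcR, Finset.card_eq_sum_ones]
      push_cast
      exact Finset.sum_le_sum fun r _ => hone _)
    (fun r hr => (hds r hr).le.trans hsR)
    (by rw [Finset.sum_comm, Finset.sum_congr rfl hds, Finset.sum_const, nsmul_eq_mul, hWcR])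
    (fun w _ => by
      rw [hsumF, ← hFcard, ← F.card_incidenceFinset_eq_degree]
      exact_mod_cast Finset.card_le_card (F.incidenceFinset_subset w))
    (by
      have h1 := F.sum_degrees_eq_twice_card_edges
      rw [hFcard] at h1
      have h2 : ∑ w, (F.degree w : ℝ) = 2 * D.card := by exact_mod_cast h1
      rw [← h2, Finset.sum_congr rfl fun w _ => hsumF w, ← Finset.sum_add_sum_compl W]
      refine (add_eq_left.2 (Finset.sum_eq_zero fun v hv => ?_)).symm
      rw [Nat.cast_eq_zero, ← F.card_neighborFinset_eq_degree, Finset.card_eq_zero,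
        Finset.eq_empty_iff_forall_notMem]
      exact fun w hw => Finset.mem_compl.1 hv (hFW v w (by simpa using hw)))
    (fun r _ => by
      refine (Finset.sum_le_card_nsmul _ _ 1 fun _ _ => hone _).trans ?_
      rw [nsmul_eq_mul, hWcR]
      linarith)
    hDR hDR'
    (by
      have h1 : 2 * (2 * (k : ℝ) - 1) * ((k - 1) * s) ≤ 2 * (2 * k - 1) * ((k - 1) * k) :=
        mul_le_mul_of_nonneg_left hc (by linarith)
      have h2 : (((k : ℝ) - 1) * s + 4) ^ 2 ≤ ((k - 1) * k + 4) ^ 2 :=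
        pow_le_pow_left₀ (by linarith) (by linarith) 2
      have h3 : (k : ℝ) ^ 3 ≥ k ^ 2 * 2 := by nlinarith [sq_nonneg (k : ℝ)]
      have h4 : (k : ℝ) ^ 2 ≥ 2 * k := by nlinarith
      nlinarith)
    (by
      have h3 : (k : ℝ) ^ 3 ≥ k ^ 2 * 2 := by nlinarith [sq_nonneg (k : ℝ)]
      have h4 : (k : ℝ) ^ 2 ≥ 2 * k := by nlinarith
      have h5 : (0 : ℝ) ≤ k ^ 4 := by positivity
      linarith)
    hx0
  rw [← hx] at key
  have := lt_of_mul_lt_mul_right key hx0.le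
  linarith

/-! ### The structure of maximal graphs that are not Hamilton-connected -/

theorem hamiltonConnected_of_forall_adj {V : Type*} [Fintype V] [DecidableEq V]
    {H : SimpleGraph V} (h : ∀ u v, u ≠ v → H.Adj u v) : HamiltonConnected H := by
  intro u
  refine hamiltonConnected_of_cover (Finset.univ : Finset V).toList [] (by simp) ?_ (by simp) ?_
    (by simpa using Finset.nodup_toList _) (by simp) u
  · exact (Finset.nodup_toList _).imp fun hab => h _ _ hab
  · simpa using Fintype.card_pos_iff.2 ⟨u⟩

/-- A partition of the vertex set into `Y`, `Z` and the rest as in the graphs `S_n^k` and `T_n^k`: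
`Y` is joined to everything, `Z` is a clique without neighbours outside `Y ∪ Z`, and the remaining
`k - 1` vertices have degree `k`. -/
structure IsBlockPartition {V : Type*} [Fintype V] [DecidableEq V] (H : SimpleGraph V)
    [DecidableRel H.Adj] (k : ℕ) (Y Z : Finset V) : Prop where
  disjoint : Disjoint Y Z
  card : (Y ∪ Z).card + k = Fintype.card V + 1
  adj_of_mem : ∀ y ∈ Y, ∀ v, y ≠ v → H.Adj y v
  clique : ∀ z ∈ Z, ∀ z' ∈ Z, z ≠ z' → H.Adj z z'
  not_adj : ∀ z ∈ Z, ∀ r ∉ Y ∪ Z, ¬ H.Adj z r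
  degree_eq : ∀ r ∉ Y ∪ Z, H.degree r = k

/-- A maximal non-Hamilton-connected graph with minimum degree at least `k` and at most
`(n - 1) (k - 1)` pairs of nonadjacent vertices is one of the two extremal graphs. -/
theorem exists_blockPartition {V : Type*} [Fintype V] [DecidableEq V] (H : SimpleGraph V)
    [DecidableRel H.Adj] {n k : ℕ} (hk : 2 ≤ k) (hV : Fintype.card V = n)
    (hn : 6 * k ^ 2 + 4 * k < n) (hH : ¬ HamiltonConnected H)
    (hmax : ∀ H', H < H' → HamiltonConnected H') (hδ : ∀ v, k ≤ H.degree v)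
    (hE : n * (n - 1) ≤ ∑ v, H.degree v + 2 * ((n - 1) * (k - 1))) :
    ∃ Y Z : Finset V, IsBlockPartition H k Y Z ∧
      ((Y.card = k ∧ ∀ r ∉ Y ∪ Z, ∀ r' ∉ Y ∪ Z, ¬ H.Adj r r') ∨
        (Y.card = 2 ∧ ∀ r ∉ Y ∪ Z, ∀ r' ∉ Y ∪ Z, r ≠ r' → H.Adj r r')) := by
  have hle : ∀ x y, x ≠ y → ¬ H.Adj x y → H.degree x + H.degree y ≤ n := fun x y h1 h2 =>
    hV ▸ degree_add_degree_le_of_maximal hH hmax h1 h2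
  have hlt : ∀ v, H.degree v ≤ n - 1 := fun v => by
    have := H.degree_lt_card_verts v
    omega
  obtain ⟨j, rfl⟩ : ∃ j, k = j + 1 := ⟨k - 1, by omega⟩
  obtain ⟨p, rfl⟩ : ∃ p, n = p + 1 := ⟨n - 1, by omega⟩
  simp only [Nat.add_sub_cancel] at hE hlt
  -- the vertices of degree more than `n / 2` form a clique, and there are few others
  set B : Finset V := Finset.univ.filter fun v => p + 2 ≤ 2 * H.degree v with hB
  have hBclique : H.IsClique (B : Set V) := by
    intro u hu v hv huv
    simp only [hB, Finset.coe_filter, Finset.mem_univ, true_and, Set.mem_ofPred_eq] at hu hv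
    by_contra h
    have := hle u v huv h
    omega
  have hBc : Bᶜ.card ≤ 4 * j := by
    have h1 : 2 * ∑ v, H.degree v ≤ B.card * (2 * p) + Bᶜ.card * (p + 1) := by
      rw [Finset.mul_sum, ← Finset.sum_add_sum_compl B]
      refine add_le_add ?_ ?_
      · exact Finset.sum_le_card_nsmul _ _ _ fun v _ => by have := hlt v; omega
      · refine Finset.sum_le_card_nsmul _ _ _ fun v hv => ?_
        simp [hB] at hv
        omega
    have h2 : B.card + Bᶜ.card = p + 1 := by rw [Finset.card_add_card_compl, hV]
    by_contra hcon
    push Not at hcon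
    have h3 : B.card * (2 * p) + Bᶜ.card * (2 * p) = (p + 1) * (2 * p) := by rw [← h2]; ring
    have h4 : (4 * j + 1) * (p - 1) ≤ Bᶜ.card * (p - 1) := Nat.mul_le_mul_right _ hcon
    obtain ⟨q, rfl⟩ : ∃ q, p = q + 1 := ⟨p - 1, by omega⟩
    simp only [Nat.add_sub_cancel] at h4
    nlinarith
  obtain ⟨C, hBC, hC⟩ := Finite.exists_le_maximal (p := fun C : Finset V => H.IsClique (C : Set V))
    hBclique
  have hCclique : ∀ u ∈ C, ∀ v ∈ C, u ≠ v → H.Adj u v := fun u hu v hv huv => hC.1 hu hv huv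
  have hcard : C.card + Cᶜ.card = p + 1 := by rw [Finset.card_add_card_compl, hV]
  have hCc : Cᶜ.card ≤ 4 * j :=
    (Finset.card_le_card (Finset.compl_subset_compl.2 hBC)).trans hBc
  have hdegC : ∀ w ∈ C, H.degree w + 1 = C.card + (Cᶜ.filter fun v => H.Adj w v).card := by
    intro w hw
    have h1 : H.neighborFinset w = C.erase w ∪ Cᶜ.filter fun v => H.Adj w v := by
      ext v
      simp only [SimpleGraph.mem_neighborFinset, Finset.mem_union, Finset.mem_erase,
        Finset.mem_filter, Finset.mem_compl]
      refine ⟨fun h => ?_, fun h => ?_⟩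
      · by_cases hv : v ∈ C
        · exact Or.inl ⟨h.ne', hv⟩
        · exact Or.inr ⟨hv, h⟩
      · rcases h with h | h
        · exact hCclique w hw v h.2 h.1.symm
        · exact h.2
    rw [← H.card_neighborFinset_eq_degree, h1, Finset.card_union_of_disjoint, add_right_comm,
      Finset.card_erase_add_one hw]
    rw [Finset.disjoint_left]
    intro v hv hv'
    simp at hv hv'
    exact hv'.1 hv.2
  have hout : ∀ v ∉ C, H.degree v ≤ Cᶜ.card + 1 := by
    intro v hv
    obtain ⟨w, hw, hvw⟩ : ∃ w ∈ C, ¬ H.Adj v w := by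
      by_contra hcon
      push Not at hcon
      refine hv (hC.2 (y := insert v C) ?_ (Finset.subset_insert _ _) (Finset.mem_insert_self _ _))
      change H.IsClique ((insert v C : Finset V) : Set V)
      rw [Finset.coe_insert, SimpleGraph.isClique_insert]
      exact ⟨hC.1, fun b hb _ => hcon b hb⟩
    have h1 := hle v w (fun h => hv (h ▸ hw)) hvw
    have h2 := hdegC w hw
    omega
  have hsum : ∑ v, H.degree v + C.card ≤ C.card * C.card + 2 * (Cᶜ.card * (Cᶜ.card + 1)) := by
    have h1 : ∑ v ∈ C, H.degree v + C.card ≤ C.card * C.card + Cᶜ.card * (Cᶜ.card + 1) := by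
      have e1 : ∑ v ∈ C, H.degree v + C.card =
          ∑ v ∈ C, (C.card + (Cᶜ.filter fun r => H.Adj v r).card) := by
        rw [Finset.card_eq_sum_ones, ← Finset.sum_add_distrib, ← Finset.card_eq_sum_ones]
        exact Finset.sum_congr rfl hdegC
      rw [e1, Finset.sum_add_distrib, Finset.sum_const, smul_eq_mul]
      refine Nat.add_le_add_left ?_ _
      have e2 : ∑ v ∈ C, (Cᶜ.filter fun r => H.Adj v r).card =
          ∑ r ∈ Cᶜ, (C.filter fun v => H.Adj v r).card :=
        Finset.sum_card_bipartiteAbove_eq_sum_card_bipartiteBelow H.Adj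
      rw [e2]
      refine Finset.sum_le_card_nsmul _ _ _ fun r hr => le_trans ?_ (hout r (Finset.mem_compl.1 hr))
      rw [← H.card_neighborFinset_eq_degree]
      refine Finset.card_le_card fun v hv => ?_
      simp at hv
      simpa using hv.2.symm
    have h2 : ∑ v ∈ Cᶜ, H.degree v ≤ Cᶜ.card * (Cᶜ.card + 1) :=
      Finset.sum_le_card_nsmul _ _ _ fun v hv => hout v (Finset.mem_compl.1 hv)
    rw [← Finset.sum_add_sum_compl C]
    omega
  have hCj : Cᶜ.card ≤ j := by
    by_contra hcon
    push Not at hcon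
    obtain ⟨i, hi⟩ := Nat.exists_eq_add_of_lt hcon
    generalize Cᶜ.card = t at *
    generalize C.card = c at *
    generalize ∑ v, H.degree v = dsum at *
    -- substituting `t = j + i + 1`, the edge count would give `2 n (i + 1) ≤ 3 t (t + 1)`
    have h1 : 2 * ((p + 1) * (i + 1)) ≤ 3 * (t * (t + 1)) := by
      subst hi
      obtain rfl : p = c + j + i := by omega
      nlinarith
    have h2 : t ≤ (j + 1) * (i + 1) := by nlinarith
    have h3 : t + 1 ≤ 4 * (j + 1) := by omega
    have h4 : t * (t + 1) ≤ ((j + 1) * (i + 1)) * (4 * (j + 1)) := Nat.mul_le_mul h2 h3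
    have h5 : (p + 1) * (i + 1) ≤ (6 * (j + 1) ^ 2) * (i + 1) := by nlinarith
    have h6 := Nat.le_of_mul_le_mul_right h5 (Nat.succ_pos i)
    omega
  have hne : ∃ v, v ∉ C := by
    by_contra hcon
    push Not at hcon
    exact hH (hamiltonConnected_of_forall_adj fun u v huv => hCclique u (hcon u) v (hcon v) huv)
  obtain ⟨v₀, hv₀⟩ := hne
  have hCj' : Cᶜ.card = j := by
    have h1 := hδ v₀
    have h2 := hout v₀ hv₀
    omega
  have hdegout : ∀ v ∉ C, H.degree v = j + 1 := fun v hv => by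
    have h1 := hδ v
    have h2 := hout v hv
    omega
  set Y : Finset V := C.filter fun y => ∃ r ∉ C, H.Adj y r with hY
  set Z : Finset V := C \ Y with hZ
  have hYC : Y ⊆ C := Finset.filter_subset _ _
  have hYZ : Y ∪ Z = C := Finset.union_sdiff_of_subset hYC
  have hYadj : ∀ y ∈ Y, ∀ v, y ≠ v → H.Adj y v := by
    intro y hy v hyv
    have hyC := hYC hy
    by_cases hv : v ∈ C
    · exact hCclique y hyC v hv hyv
    · by_contra hcon
      obtain ⟨r, hr, hyr⟩ := (Finset.mem_filter.1 hy).2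
      have h1 := hle y v hyv hcon
      have h2 := hdegC y hyC
      have h3 : 0 < (Cᶜ.filter fun v => H.Adj y v).card :=
        Finset.card_pos.2 ⟨r, by simp [hr, hyr]⟩
      have h4 := hdegout v hv
      omega
  have hZadj : ∀ z ∈ Z, ∀ r ∉ C, ¬ H.Adj z r := by
    intro z hz r hr hzr
    rw [hZ, Finset.mem_sdiff] at hz
    exact hz.2 (Finset.mem_filter.2 ⟨hz.1, r, hr, hzr⟩)
  have hYR : ∀ r ∉ C, Y.card + (Cᶜ.filter fun v => H.Adj r v).card = j + 1 := by
    intro r hr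
    rw [← hdegout r hr, ← H.card_neighborFinset_eq_degree, ← Finset.card_union_of_disjoint]
    · congr 1
      ext v
      simp only [SimpleGraph.mem_neighborFinset, Finset.mem_union, Finset.mem_filter,
        Finset.mem_compl]
      refine ⟨fun h => ?_, fun h => ?_⟩
      · rcases h with h | h
        · exact (hYadj v h r fun e => hr (e ▸ hYC h)).symm
        · exact h.2
      · by_cases hv : v ∈ C
        · exact Or.inl (Finset.mem_filter.2 ⟨hv, r, hr, h.symm⟩)
        · exact Or.inr ⟨hv, h⟩
    · rw [Finset.disjoint_left]
      intro v hv hv'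
      simp at hv'
      exact hv'.1 (hYC hv)
  have hRsub : ∀ r ∉ C, (Cᶜ.filter fun v => H.Adj r v) ⊆ Cᶜ.erase r := by
    intro r hr v hv
    rw [Finset.mem_filter] at hv
    exact Finset.mem_erase.2 ⟨hv.2.ne', hv.1⟩
  have hRcard : ∀ r ∉ C, (Cᶜ.erase r).card + 1 = j := fun r hr => by
    rw [Finset.card_erase_add_one (Finset.mem_compl.2 hr), hCj']
  refine ⟨Y, Z, ⟨Finset.disjoint_sdiff, ?_, hYadj, ?_, ?_, ?_⟩, ?_⟩
  · rw [hYZ]; omega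
  · intro z hz z' hz' h
    exact hCclique z (Finset.sdiff_subset hz) z' (Finset.sdiff_subset hz') h
  · rw [hYZ]; exact hZadj
  · rw [hYZ]; exact hdegout
  rw [hYZ]
  rcases lt_trichotomy Y.card 2 with h2 | h2 | h2
  · exfalso
    have h1 := hYR v₀ hv₀
    have h3 := Finset.card_le_card (hRsub v₀ hv₀)
    have h4 := hRcard v₀ hv₀
    omega
  · right
    refine ⟨h2, fun r hr r' hr' hrr' => ?_⟩
    have h1 := hYR r hr
    have h4 := hRcard r hr
    have h5 := Finset.eq_of_subset_of_card_le (hRsub r hr) (by omega)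
    have h6 : r' ∈ Cᶜ.filter fun v => H.Adj r v := by
      rw [h5, Finset.mem_erase, Finset.mem_compl]
      exact ⟨hrr'.symm, hr'⟩
    exact (Finset.mem_filter.1 h6).2
  · left
    have hYk : Y.card = j + 1 := by
      by_contra hYne
      have hYle : Y.card + 1 ≤ j + 1 := by have := hYR v₀ hv₀; omega
      obtain ⟨Ks, h1, hKnd, hKm, h4⟩ := exists_path_cover (G := H) Cᶜ (j + 1 - Y.card) (by omega)
        (by omega) (fun r hr => by have := hYR r (Finset.mem_compl.1 hr); omega)
      apply hH
      have hm : ∀ w, w ∈ (Z.toList :: Ks).flatten ↔ w ∈ Z ∨ w ∉ C := fun w => by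
        rw [List.flatten_cons, List.mem_append, hKm, Finset.mem_toList, Finset.mem_compl]
      refine hamiltonConnected_of_cover Y.toList (Z.toList :: Ks) ?_ ?_ ?_ ?_ ?_ ?_
      · intro L hL
        rcases List.mem_cons.1 hL with rfl | hL
        · refine List.Pairwise.isChain ((Finset.nodup_toList Z).pairwise_of_forall_ne ?_)
          intro a ha b hb hab
          rw [Finset.mem_toList] at ha hb
          exact hCclique a (Finset.sdiff_subset ha) b (Finset.sdiff_subset hb) hab
        · exact h1 L hL
      · refine (Finset.nodup_toList Y).pairwise_of_forall_ne ?_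
        intro a ha b hb hab
        rw [Finset.mem_toList] at ha hb
        exact hYadj a ha b hab
      · intro a ha b hb
        rw [Finset.mem_toList] at ha
        refine hYadj a ha b ?_
        rintro rfl
        rcases (hm a).1 hb with h | h
        · exact (Finset.mem_sdiff.1 h).2 ha
        · exact h (hYC ha)
      · rw [List.length_cons, Finset.length_toList]
        omega
      · rw [List.nodup_append, List.flatten_cons, List.nodup_append]
        refine ⟨Finset.nodup_toList Y, ⟨Finset.nodup_toList Z, hKnd, ?_⟩, ?_⟩
        · rintro a ha b hb rfl
          rw [Finset.mem_toList] at ha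
          exact Finset.mem_compl.1 ((hKm a).1 hb) (Finset.sdiff_subset ha)
        · rintro a ha b hb rfl
          rw [Finset.mem_toList] at ha
          rw [← List.flatten_cons] at hb
          rcases (hm a).1 hb with h | h
          · exact (Finset.mem_sdiff.1 h).2 ha
          · exact h (hYC ha)
      · intro w
        rw [List.mem_append, hm, Finset.mem_toList]
        by_cases hw : w ∈ C
        · rw [← hYZ, Finset.mem_union] at hw
          tauto
        · exact Or.inr (Or.inr hw)
    refine ⟨hYk, fun r hr r' hr' hrr' => ?_⟩
    have h1 := hYR r hr
    have h3 : (Cᶜ.filter fun v => H.Adj r v) = ∅ := Finset.card_eq_zero.1 (by omega)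
    have h6 : r' ∈ Cᶜ.filter fun v => H.Adj r v := by simp [hr', hrr']
    rw [h3] at h6
    simp at h6

/-! ### Recognising the two families -/

theorem join_adj_cases {V W : Type*} (G : SimpleGraph V) (H : SimpleGraph W) :
    (∀ a b, (join G H).Adj (Sum.inl a) (Sum.inl b) ↔ G.Adj a b) ∧
    (∀ a b, (join G H).Adj (Sum.inr a) (Sum.inr b) ↔ H.Adj a b) ∧
    (∀ a b, (join G H).Adj (Sum.inl a) (Sum.inr b)) ∧
    ∀ a b, (join G H).Adj (Sum.inr a) (Sum.inl b) := by
  refine ⟨?_, ?_, ?_, ?_⟩ <;> intros <;> simp [join]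

/-- A partition of a finite type into two sets and the rest, as an equivalence with a sum. -/
theorem exists_equiv_sum {V : Type*} [Fintype V] [DecidableEq V] {Y Z : Finset V}
    (hYZ : Disjoint Y Z) {a b c : ℕ} (ha : Y.card = a) (hb : Z.card = b)
    (hc : (Y ∪ Z)ᶜ.card = c) :
    ∃ φ : Fin a ⊕ (Fin b ⊕ Fin c) ≃ V, (∀ i, φ (Sum.inl i) ∈ Y) ∧
      (∀ i, φ (Sum.inr (Sum.inl i)) ∈ Z) ∧ ∀ i, φ (Sum.inr (Sum.inr i)) ∉ Y ∪ Z := by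
  let eY := (Y.equivFinOfCardEq ha).symm
  let eZ := (Z.equivFinOfCardEq hb).symm
  let eR := ((Y ∪ Z)ᶜ.equivFinOfCardEq hc).symm
  let f : Fin a ⊕ (Fin b ⊕ Fin c) → V :=
    Sum.elim (fun i => eY i) (Sum.elim (fun i => eZ i) fun i => eR i)
  have hY : ∀ i, (eY i : V) ∈ Y := fun i => (eY i).2
  have hZ : ∀ i, (eZ i : V) ∈ Z := fun i => (eZ i).2
  have hR : ∀ i, (eR i : V) ∉ Y ∪ Z := fun i => Finset.mem_compl.1 (eR i).2
  have hbij : Function.Bijective f := by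
    constructor
    · have iY : Function.Injective fun i => (eY i : V) := Subtype.val_injective.comp eY.injective
      have iZ : Function.Injective fun i => (eZ i : V) := Subtype.val_injective.comp eZ.injective
      have iR : Function.Injective fun i => (eR i : V) := Subtype.val_injective.comp eR.injective
      refine iY.sumElim (iZ.sumElim iR ?_) ?_
      · intro i j h
        exact hR j (Finset.mem_union_right _ (h ▸ hZ i))
      · rintro i (j | j) h
        · exact Finset.disjoint_left.1 hYZ (hY i) (by
            rw [show (eY i : V) = eZ j from h]; exact hZ j)
        · exact hR j (Finset.mem_union_left _ (by
            rw [← show (eY i : V) = eR j from h]; exact hY i))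
    · intro v
      by_cases h1 : v ∈ Y
      · exact ⟨Sum.inl (eY.symm ⟨v, h1⟩), by simp [f]⟩
      by_cases h2 : v ∈ Z
      · exact ⟨Sum.inr (Sum.inl (eZ.symm ⟨v, h2⟩)), by simp [f]⟩
      · exact ⟨Sum.inr (Sum.inr (eR.symm ⟨v, by simp [h1, h2]⟩)), by simp [f]⟩
  exact ⟨Equiv.ofBijective f hbij, hY, hZ, hR⟩

/-- A spanning subgraph of `H` is a deletion as soon as few edges are missing and these join
vertices of degree `n - 1` or `n - k`. -/
theorem isDeletion_of_iso {V W : Type*} [Fintype V] [DecidableEq V] [Fintype W]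
    {G H : SimpleGraph V} [DecidableRel G.Adj] [DecidableRel H.Adj] (hGH : G ≤ H)
    {K : SimpleGraph W} (φ : H ≃g K) {n k m : ℕ}
    (hends : ∀ u v, H.Adj u v → ¬ G.Adj u v → H.degree u = n - 1 ∨ H.degree u = n - k)
    (hcard : (H.edgeFinset \ G.edgeFinset).card ≤ m) : IsDeletion G K n k m := by
  classical
  have hmem : ∀ a b, s(φ a, φ b) ∈ (H.edgeFinset \ G.edgeFinset).image (Sym2.map φ) ↔
      H.Adj a b ∧ ¬ G.Adj a b := by
    intro a b
    rw [← Sym2.map_mk, (Sym2.map.injective φ.injective).mem_finset_image]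
    simp
  refine ⟨(H.edgeFinset \ G.edgeFinset).image (Sym2.map φ), ?_, Finset.card_image_le.trans hcard,
    ⟨⟨φ.toEquiv, ?_⟩⟩⟩
  · intro e he
    induction e with
    | _ x y =>
    obtain ⟨a, rfl⟩ := φ.surjective x
    obtain ⟨b, rfl⟩ := φ.surjective y
    rw [Finset.mem_coe, hmem] at he
    refine ⟨φ.map_adj_iff.2 he.1, ?_⟩
    intro v hv
    have hdeg : ∀ a, H.degree a = n - 1 ∨ H.degree a = n - k → φ a ∈ YZ K n k := by
      intro a ha
      rw [← φ.degree_eq a] at ha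
      exact ha
    rw [Sym2.mem_iff] at hv
    rcases hv with rfl | rfl
    · exact hdeg a (hends a b he.1 he.2)
    · exact hdeg b (hends b a he.1.symm fun h => he.2 h.symm)
  · intro a b
    change (K.deleteEdges _).Adj (φ a) (φ b) ↔ _
    rw [SimpleGraph.deleteEdges_adj, Finset.mem_coe, hmem, φ.map_adj_iff]
    have := @hGH a b
    tauto

/-- With `Y` of size `k` and an independent rest, the block partition describes `S_n^k`. -/
theorem IsBlockPartition.nonempty_iso_S {V : Type*} [Fintype V] [DecidableEq V]
    {H : SimpleGraph V} [DecidableRel H.Adj] {n k : ℕ} {Y Z : Finset V}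
    (h : IsBlockPartition H k Y Z) (hk : 2 ≤ k) (hV : Fintype.card V = n) (hY : Y.card = k)
    (hR : ∀ r ∉ Y ∪ Z, ∀ r' ∉ Y ∪ Z, ¬ H.Adj r r') : Nonempty (H ≃g S n k) := by
  have h1 := h.card
  have h2 := Finset.card_union_of_disjoint h.disjoint
  have h3 := Finset.card_add_card_compl (Y ∪ Z)
  obtain ⟨φ, hφY, hφZ, hφR⟩ := exists_equiv_sum h.disjoint (a := k) (b := n - (2 * k - 1))
    (c := k - 1) hY (by omega) (by omega)
  obtain ⟨j1, j2, j3, j4⟩ := join_adj_cases (SimpleGraph.completeGraph (Fin k))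
    ((SimpleGraph.completeGraph (Fin (n - (2 * k - 1)))).sum (⊥ : SimpleGraph (Fin (k - 1))))
  refine ⟨(⟨φ, ?_⟩ : S n k ≃g H).symm⟩
  rintro (a | a | a) (b | b | b)
  · rw [S, j1, SimpleGraph.completeGraph_eq_top, SimpleGraph.top_adj]
    exact ⟨fun hab => by rintro rfl; exact hab.ne rfl,
      fun hab => h.adj_of_mem _ (hφY a) _ (by simpa using hab)⟩
  · exact iff_of_true (h.adj_of_mem _ (hφY a) _ (by simp)) (j3 _ _)
  · exact iff_of_true (h.adj_of_mem _ (hφY a) _ (by simp)) (j3 _ _)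
  · exact iff_of_true (h.adj_of_mem _ (hφY b) _ (by simp)).symm (j4 _ _)
  · rw [S, j2, SimpleGraph.sum_adj_inl, SimpleGraph.completeGraph_eq_top, SimpleGraph.top_adj]
    exact ⟨fun hab => by rintro rfl; exact hab.ne rfl,
      fun hab => h.clique _ (hφZ a) _ (hφZ b) (by simpa using hab)⟩
  · rw [S, j2]
    exact iff_of_false (h.not_adj _ (hφZ a) _ (hφR b)) (by simp)
  · exact iff_of_true (h.adj_of_mem _ (hφY b) _ (by simp)).symm (j4 _ _)
  · rw [S, j2]
    exact iff_of_false (fun hab => h.not_adj _ (hφZ b) _ (hφR a) hab.symm) (by simp)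
  · rw [S, j2]
    exact iff_of_false (hR _ (hφR a) _ (hφR b)) (by simp)

/-- With `Y` of size `2` and a complete rest, the block partition describes `T_n^k`. -/
theorem IsBlockPartition.nonempty_iso_T {V : Type*} [Fintype V] [DecidableEq V]
    {H : SimpleGraph V} [DecidableRel H.Adj] {n k : ℕ} {Y Z : Finset V}
    (h : IsBlockPartition H k Y Z) (hk : 2 ≤ k) (hV : Fintype.card V = n) (hY : Y.card = 2)
    (hR : ∀ r ∉ Y ∪ Z, ∀ r' ∉ Y ∪ Z, r ≠ r' → H.Adj r r') : Nonempty (H ≃g T n k) := by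
  have h1 := h.card
  have h2 := Finset.card_union_of_disjoint h.disjoint
  have h3 := Finset.card_add_card_compl (Y ∪ Z)
  obtain ⟨φ, hφY, hφZ, hφR⟩ := exists_equiv_sum h.disjoint (a := 2) (b := n - (k + 1))
    (c := k - 1) hY (by omega) (by omega)
  obtain ⟨j1, j2, j3, j4⟩ := join_adj_cases (SimpleGraph.completeGraph (Fin 2))
    ((SimpleGraph.completeGraph (Fin (n - (k + 1)))).sum
      (SimpleGraph.completeGraph (Fin (k - 1))))
  refine ⟨(⟨φ, ?_⟩ : T n k ≃g H).symm⟩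
  rintro (a | a | a) (b | b | b)
  · rw [T, j1, SimpleGraph.completeGraph_eq_top, SimpleGraph.top_adj]
    exact ⟨fun hab => by rintro rfl; exact hab.ne rfl,
      fun hab => h.adj_of_mem _ (hφY a) _ (by simpa using hab)⟩
  · exact iff_of_true (h.adj_of_mem _ (hφY a) _ (by simp)) (j3 _ _)
  · exact iff_of_true (h.adj_of_mem _ (hφY a) _ (by simp)) (j3 _ _)
  · exact iff_of_true (h.adj_of_mem _ (hφY b) _ (by simp)).symm (j4 _ _)
  · rw [T, j2, SimpleGraph.sum_adj_inl, SimpleGraph.completeGraph_eq_top, SimpleGraph.top_adj]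
    exact ⟨fun hab => by rintro rfl; exact hab.ne rfl,
      fun hab => h.clique _ (hφZ a) _ (hφZ b) (by simpa using hab)⟩
  · rw [T, j2]
    exact iff_of_false (h.not_adj _ (hφZ a) _ (hφR b)) (by simp)
  · exact iff_of_true (h.adj_of_mem _ (hφY b) _ (by simp)).symm (j4 _ _)
  · rw [T, j2]
    exact iff_of_false (fun hab => h.not_adj _ (hφZ b) _ (hφR a) hab.symm) (by simp)
  · rw [T, j2, SimpleGraph.sum_adj_inr, SimpleGraph.completeGraph_eq_top, SimpleGraph.top_adj]
    exact ⟨fun hab => by rintro rfl; exact hab.ne rfl,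
      fun hab => hR _ (hφR a) _ (hφR b) (by simpa using hab)⟩

/-- A spanning subgraph `G` of minimum degree `k` with `q(G) ≥ 2 (n - k)` arises from a graph with a
block partition by deleting few edges inside `Y ∪ Z`: the other vertices keep all their edges. -/
theorem IsBlockPartition.isDeletion {V W : Type*} [Fintype V] [DecidableEq V] [Fintype W]
    {G H : SimpleGraph V} [DecidableRel G.Adj] [DecidableRel H.Adj] {n k m : ℕ} {Y Z : Finset V}
    (h : IsBlockPartition H k Y Z) (hGH : G ≤ H) (hk : 2 ≤ k) (hV : Fintype.card V = n)
    (hn : k ^ 4 + 5 * k ^ 3 + 2 * k ^ 2 + 8 * k + 12 ≤ n) (hδ : ∀ v, k ≤ G.degree v)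
    (hq : 2 * (n : ℝ) - 2 * k ≤ q G) (hY : Y.card ≤ k)
    (hm : (k - 1) * Y.card + 2 ≤ 4 * (m + 1)) (hm' : 4 * (m + 1) ≤ (k - 1) * Y.card + 4)
    {K : SimpleGraph W} (φ : H ≃g K) : IsDeletion G K n k m := by
  have hne : Nonempty V := Fintype.card_pos_iff.1 (by omega)
  have hnb : ∀ r ∉ Y ∪ Z, G.neighborFinset r = H.neighborFinset r := fun r hr =>
    Finset.eq_of_subset_of_card_le (fun v hv => by simpa using hGH (by simpa using hv)) (by
      rw [G.card_neighborFinset_eq_degree, H.card_neighborFinset_eq_degree, h.degree_eq r hr]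
      exact hδ r)
  have hGr : ∀ r ∉ Y ∪ Z, ∀ v, G.Adj r v ↔ H.Adj r v := fun r hr v => by
    rw [← G.mem_neighborFinset, hnb r hr, H.mem_neighborFinset]
  have hmiss : ∀ u v, H.Adj u v → ¬ G.Adj u v → u ∈ Y ∪ Z := fun u v h1 h2 => by
    by_contra hu
    exact h2 ((hGr u hu v).2 h1)
  refine isDeletion_of_iso hGH φ (fun u v h1 h2 => ?_) ?_
  · have hu := hmiss u v h1 h2
    by_cases huY : u ∈ Y
    · left
      have : H.neighborFinset u = Finset.univ.erase u := by
        ext w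
        simp only [SimpleGraph.mem_neighborFinset, Finset.mem_erase, Finset.mem_univ, and_true]
        exact ⟨fun hw => hw.ne', fun hw => h.adj_of_mem u huY w hw.symm⟩
      rw [← H.card_neighborFinset_eq_degree, this, Finset.card_erase_of_mem (Finset.mem_univ u),
        Finset.card_univ, hV]
    · right
      have huZ : u ∈ Z := (Finset.mem_union.1 hu).resolve_left huY
      have : H.neighborFinset u = (Y ∪ Z).erase u := by
        ext w
        simp only [SimpleGraph.mem_neighborFinset, Finset.mem_erase]
        refine ⟨fun hw => ⟨hw.ne', ?_⟩, fun hw => ?_⟩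
        · by_contra hcon
          exact h.not_adj u huZ w hcon hw
        · rcases Finset.mem_union.1 hw.2 with h3 | h3
          · exact (h.adj_of_mem w h3 u hw.1).symm
          · exact h.clique u huZ w h3 hw.1.symm
      have hc := h.card
      rw [← H.card_neighborFinset_eq_degree, this, Finset.card_erase_of_mem hu]
      omega
  · by_contra hcon
    push Not at hcon
    obtain ⟨D, hDsub, hDcard⟩ := Finset.exists_subset_card_eq (Nat.succ_le_of_lt hcon)
    rw [Nat.succ_eq_add_one] at hDcard
    have hD : ∀ e ∈ D, e ∈ H.edgeSet ∧ e ∉ G.edgeSet := fun e he => by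
      simpa using hDsub he
    refine absurd hq (not_le.2 (q_lt_of_missing_edges G hk hV hn (Y ∪ Z) (hV ▸ h.card) hY ?_ D
      (fun e he => (hD e he).2) (fun e he => H.not_isDiag_of_mem_edgeSet (hD e he).1) ?_
      (by rw [hDcard]; exact hm) (by rw [hDcard]; exact hm')))
    · intro r hr
      congr 1
      ext w
      rw [Finset.mem_filter, hGr r hr]
      refine ⟨fun hw => ?_, fun hw => ⟨Finset.mem_union_left _ hw, ?_⟩⟩
      · refine (Finset.mem_union.1 hw.1).resolve_right fun hZ => ?_
        exact h.not_adj w hZ r hr hw.2.symm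
      · exact (h.adj_of_mem w hw r fun e => hr (e ▸ Finset.mem_union_left _ hw)).symm
    · intro e he v hv
      induction e with
      | _ a b =>
      have := hD _ he
      rw [Sym2.mem_iff] at hv
      rcases hv with rfl | rfl
      · exact hmiss v b this.1 this.2
      · exact hmiss v a this.1.symm fun h => this.2 h.symm

end HamConn

theorem theorem1p1 {V : Type*} [Fintype V] [DecidableEq V] (G : SimpleGraph V)
    [DecidableRel G.Adj] (n k : ℕ) (hk : 2 ≤ k) (hV : Fintype.card V = n)
    (hn : k ^ 4 + 5 * k ^ 3 + 2 * k ^ 2 + 8 * k + 12 ≤ n)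
    (hδ : k ≤ G.minDegree)
    (hq : 2 * (n : ℝ) - 2 * (k : ℝ) ≤ HamConn.q G)
    (hG : ¬ (HamConn.MemS1 G n k ∨ HamConn.MemT1 G n k)) :
    HamConn.HamiltonConnected G := by
  classical
  have hne : Nonempty V := Fintype.card_pos_iff.1 (by omega)
  have hδ' : ∀ v, k ≤ G.degree v := fun v => hδ.trans (G.minDegree_le_degree v)
  by_contra hnot
  obtain ⟨H, hGH, hH⟩ := Finite.exists_le_maximal
    (p := fun H : SimpleGraph V => ¬ HamConn.HamiltonConnected H) hnot
  have hmax : ∀ H', H < H' → HamConn.HamiltonConnected H' := fun H' hlt => by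
    by_contra hcon
    exact hH.not_prop_of_gt hlt hcon
  have hdeg : ∀ v, G.degree v ≤ H.degree v := fun v => SimpleGraph.degree_le_of_le hGH
  have hE : n * (n - 1) ≤ ∑ v, H.degree v + 2 * ((n - 1) * (k - 1)) := by
    have h1 := HamConn.q_mul_le G fun v => lt_of_lt_of_le (by omega) (hδ' v)
    rw [hV] at h1
    have h2 : ∑ v, (G.degree v : ℝ) ≤ ∑ v, (H.degree v : ℝ) :=
      Finset.sum_le_sum fun v _ => by exact_mod_cast hdeg v
    have hn1 : (1 : ℝ) ≤ n := by exact_mod_cast (by omega : 1 ≤ n)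
    have h3 : (2 * (n : ℝ) - 2 * k) * (n - 1) ≤ HamConn.q G * (n - 1) :=
      mul_le_mul_of_nonneg_right hq (by linarith)
    have h4 : ((n * (n - 1) : ℕ) : ℝ) ≤
        ((∑ v, H.degree v + 2 * ((n - 1) * (k - 1)) : ℕ) : ℝ) := by
      push_cast [Nat.cast_sub (by omega : 1 ≤ n), Nat.cast_sub (by omega : 1 ≤ k)]
      linarith
    exact_mod_cast h4
  have hn' : 6 * k ^ 2 + 4 * k < n := by
    have h1 : k ^ 3 ≥ 2 * k ^ 2 := by nlinarith [sq_nonneg k]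
    have h2 : 0 ≤ k ^ 4 := Nat.zero_le _
    nlinarith
  obtain ⟨Y, Z, hP, hcases⟩ := HamConn.exists_blockPartition H hk hV hn' hH.1 hmax
    (fun v => (hδ' v).trans (hdeg v)) hE
  apply hG
  rcases hcases with ⟨hY, hR⟩ | ⟨hY, hR⟩
  · left
    obtain ⟨φ⟩ := hP.nonempty_iso_S hk hV hY hR
    have heven : Even (k * (k - 1)) := Nat.even_mul_pred_self k
    rw [Nat.even_iff] at heven
    refine hP.isDeletion hGH hk hV hn hδ' hq hY.le ?_ ?_ φ <;> rw [hY, Nat.mul_comm (k - 1) k] <;>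
      omega
  · right
    obtain ⟨φ⟩ := hP.nonempty_iso_T hk hV hY hR
    refine hP.isDeletion hGH hk hV hn hδ' hq (hY.trans_le hk) ?_ ?_ φ <;> rw [hY] <;> omega
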